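/- Let $n\ge 2$, let $N$ be a compact smooth $(n-1)$-dimensional manifold, with or without boundary, let $-\infty\le a<b\le+\infty$ and $M=(a,b)\times N$. Let $g=dr^2+G(r)$ be a smooth Riemannian metric on $M$, where $G(r)$, $r\in(a,b)$, is a family of Riemannian metrics on $N$, and let $g_0=dr^2+\mathring G(r)$ with $\mathring G(r)=\mathring h(r)^2\hat G$, where $\mathring h$ is a smooth positive function on $(a,b)$ and $\hat G$ is a fixed smooth Riemannian metric on $N$ with volume measure $\mu_{\hat G}$. Let $H$ and $\mathring H$ be the mean curvatures (traces of the Weingarten maps $X\mapsto\nabla_X\partial_r$) of the level sets $\{r\}\times N$ for $g$ and $g_0$, let $R_{rr}$ and $\mathring R_{rr}$ be the Ricci curvatures of $g$ and $g_0$ in the direction $(\partial_r,\partial_r)$, and set $$m(r,x)=\mathring h(r)^2\bigl(\mathring H(r,x)-H(r,x)\bigr),\qquad \mathcal M(r)=\int_N m(r,x)\,d\mu_{\hat G}(x).$$ Assume that the (finite) limits $\mathcal M(a)=\lim_{r\to a}\mathcal M(r)$ and $\mathcal M(b)=\lim_{r\to b}\mathcal M(r)$ exist, that $\mathring h^2(R_{rr}-\mathring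 R_{rr})\in L^1(M,dr\,d\mu_{\hat G})$, and that $$\int_M\mathring h^2(R_{rr}-\mathring R_{rr})\,dr\,d\mu_{\hat G}\ \ge\ 0 .$$ Then $\mathcal M(b)\ge\mathcal M(a)$, and $\mathcal M(b)=\mathcal M(a)$ if and only if there is a fixed Riemannian metric $\widetilde G$ on $N$ with $G(r)=\mathring h(r)^2\widetilde G$ for all $r\in(a,b)$. If moreover $g$ is asymptotic to $g_0$ at some $r_0\in[a,b]$, that is, $\|G(r)-\mathring G(r)\|_{\mathring G(r)}\to0$ uniformly on $N$ as $r\to r_0$ in $(a,b)$, then $\mathcal M(b)=\mathcal M(a)$ if and only if $g=g_0$. -/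

import Mathlib

open Set Filter Topology MeasureTheory Bundle
open scoped Manifold ContDiff

noncomputable section

namespace RadialMass

/-! ### Levi-Civita connection and Ricci curvature in coordinates

`V` is the space of coordinates, `D ⊆ V` the coordinate domain (relatively open in a half space
when there is a boundary), `e` the coordinate directions, `g` the matrix `(g_{ij})` of a metric. -/

section Coordinates

variable {V κ : Type*} [NormedAddCommGroup V] [NormedSpace ℝ V] [Fintype κ] [DecidableEq κ]

/-- The partial derivative `∂_i f`. -/
def partialD (D : Set V) (e : κ → V) (i : κ) (f : V → ℝ) (z : V) : ℝ :=
  fderivWithin ℝ f D z (e i)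

/-- `christoffel D e g k i j` is the Christoffel symbol `Γ^k_{ij}`, equal to
`½ g^{kl} (∂_i g_{jl} + ∂_j g_{il} - ∂_l g_{ij})`. -/
def christoffel (D : Set V) (e : κ → V) (g : V → Matrix κ κ ℝ) (k i j : κ) (z : V) : ℝ :=
  (1 / 2) * ∑ l, (g z)⁻¹ k l *
    (partialD D e i (fun w => g w j l) z + partialD D e j (fun w => g w i l) z
      - partialD D e l (fun w => g w i j) z)

/-- The Ricci tensor
`R_{ij} = ∂_k Γ^k_{ij} - ∂_j Γ^k_{ik} + Γ^k_{kl} Γ^l_{ij} - Γ^k_{jl} Γ^l_{ik}`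
(positive on round spheres). -/
def ricci (D : Set V) (e : κ → V) (g : V → Matrix κ κ ℝ) (i j : κ) (z : V) : ℝ :=
  (∑ k, partialD D e k (christoffel D e g k i j) z)
    - (∑ k, partialD D e j (christoffel D e g k i k) z)
    + (∑ k, ∑ l, christoffel D e g k k l z * christoffel D e g l i j z)
    - ∑ k, ∑ l, christoffel D e g k j l z * christoffel D e g l i k z

end Coordinates

section Manifold

variable {d : ℕ} {H : Type*} [TopologicalSpace H]
  (I : ModelWithCorners ℝ (EuclideanSpace ℝ (Fin d)) H)
  {N : Type*} [TopologicalSpace N] [ChartedSpace H N]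

/-- A field of bilinear forms on the tangent spaces of `N`. -/
abbrev BilinField (N : Type*) [TopologicalSpace N] [ChartedSpace H N] : Type _ :=
  (x : N) → TangentSpace I x →L[ℝ] TangentSpace I x →L[ℝ] ℝ

/-- A smooth Riemannian metric on `N`. -/
abbrev RiemMetric (N : Type*) [TopologicalSpace N] [ChartedSpace H N] [IsManifold I ∞ N] : Type _ :=
  ContMDiffRiemannianMetric (B := N) I ∞ (EuclideanSpace ℝ (Fin d)) (fun x : N => TangentSpace I x)

/-- The coordinate vector `∂_A` of the chart around `x₀`, at the point with coordinates `y`. -/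
def coordVector (x₀ : N) (y : EuclideanSpace ℝ (Fin d)) (A : Fin d) :
    TangentSpace I ((extChartAt I x₀).symm y) :=
  mfderivWithin 𝓘(ℝ, EuclideanSpace ℝ (Fin d)) I (extChartAt I x₀).symm (range I) y
    (EuclideanSpace.single A (1 : ℝ) : EuclideanSpace ℝ (Fin d))

/-- The matrix `B_{AB}(y) = B(∂_A, ∂_B)` of a field of bilinear forms in the chart around `x₀`. -/
def coordMatrix (B : BilinField I N) (x₀ : N) (y : EuclideanSpace ℝ (Fin d)) :
    Matrix (Fin d) (Fin d) ℝ :=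
  Matrix.of fun A C =>
    B ((extChartAt I x₀).symm y) (coordVector I x₀ y A) (coordVector I x₀ y C)

/-- The contribution of the chart around `c` to the Riemannian volume:
the push-forward to `N` of `ρ √(det G_{AB}) dy`. -/
def chartVolume [MeasurableSpace N] (B : BilinField I N) (ρ : N → ℝ) (c : N) : Measure N :=
  Measure.map (extChartAt I c).symm
    ((volume.restrict (extChartAt I c).target).withDensity fun y =>
      ENNReal.ofReal (ρ ((extChartAt I c).symm y) * √(coordMatrix I B c y).det))

variable (N) in
/-- Some smooth partition of unity subordinate to the charts of `N`. -/
def chartPartition [T2Space N] [SigmaCompactSpace N] [IsManifold I ∞ N] :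
    SmoothPartitionOfUnity N I N univ :=
  Classical.choose (SmoothPartitionOfUnity.exists_isSubordinate_chartAt_source I N)

/-- The Riemannian volume measure of a metric, `∑_c ρ_c √(det G_{AB}) dy` for a partition of unity
`(ρ_c)` subordinate to the charts. By the change of variables formula
it does not depend on the partition. -/
def riemannianVolume [T2Space N] [SigmaCompactSpace N] [IsManifold I ∞ N] [MeasurableSpace N]
    (G : RiemMetric I N) : Measure N :=
  Measure.sum fun c : N => chartVolume I G.inner (chartPartition I N c) c

/-! ### Metrics `dr² + G(r)` on `(a, b) × N`

The coordinates adapted to `M` are `(r, x^A)`; the index set is `Unit ⊕ Fin d`, the index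
`Sum.inl ()` being that of `r`. -/

/-- The coordinate domain `ℝ × φ(U)` for the chart `φ : U → φ(U)` of `N` around `x₀`. -/
def adaptedDomain (x₀ : N) : Set (ℝ × EuclideanSpace ℝ (Fin d)) :=
  univ ×ˢ (extChartAt I x₀).target

/-- The coordinate directions of `(r, x^A)`. -/
def adaptedFrame (d : ℕ) : Unit ⊕ Fin d → ℝ × EuclideanSpace ℝ (Fin d)
  | Sum.inl _ => (1, 0)
  | Sum.inr A => (0, EuclideanSpace.single A (1 : ℝ))

/-- The matrix of the metric `dr² + G(r)` in the coordinates `(r, x^A)`, for the chart of `N`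
around `x₀`. -/
def adaptedMatrix (G : ℝ → BilinField I N) (x₀ : N) (z : ℝ × EuclideanSpace ℝ (Fin d)) :
    Matrix (Unit ⊕ Fin d) (Unit ⊕ Fin d) ℝ :=
  Matrix.fromBlocks 1 0 0 (coordMatrix I (G z.1) x₀ z.2)

/-- The Ricci curvature `R_{rr}` of `dr² + G(r)` in the direction `(∂_r, ∂_r)` at `(r, x)`. -/
def ricciRR (G : ℝ → BilinField I N) (r : ℝ) (x : N) : ℝ :=
  ricci (adaptedDomain I x) (adaptedFrame d) (adaptedMatrix I G x) (Sum.inl ()) (Sum.inl ())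
    (r, extChartAt I x x)

/-- The Weingarten map `X ↦ ∇_X ∂_r` of the level set `N(r)` with respect to the unit normal `∂_r`,
for `dr² + G(r)`, at `(r, x)`: its entries are `S^B_A = Γ^B_{Ar}`. -/
def weingarten (G : ℝ → BilinField I N) (r : ℝ) (x : N) : Matrix (Fin d) (Fin d) ℝ :=
  Matrix.of fun B A =>
    christoffel (adaptedDomain I x) (adaptedFrame d) (adaptedMatrix I G x)
      (Sum.inr B) (Sum.inr A) (Sum.inl ()) (r, extChartAt I x x)

/-- The mean curvature of the level set `N(r)` for `dr² + G(r)`, at `(r, x)`. -/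
def meanCurvature (G : ℝ → BilinField I N) (r : ℝ) (x : N) : ℝ :=
  (weingarten I G r x).trace

/-- The family `r ↦ h(r)² Ĝ`. -/
def warped (h : ℝ → ℝ) (B : BilinField I N) : ℝ → BilinField I N :=
  fun r x => (h r) ^ 2 • B x

/-- The radial mass `m(r, x)` of `dr² + G(r)` relative to `dr² + h² Ĝ`. -/
def mass (h : ℝ → ℝ) (Ghat : BilinField I N) (G : ℝ → BilinField I N) (r : ℝ) (x : N) : ℝ :=
  (h r) ^ 2 * (meanCurvature I (warped I h Ghat) r x - meanCurvature I G r x)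

/-- The radial mass of `dr² + G(r)` relative to `dr² + h² Ĝ` on `N(r)`. -/
def totalMass [T2Space N] [SigmaCompactSpace N] [IsManifold I ∞ N] [MeasurableSpace N]
    (h : ℝ → ℝ) (Ghat : RiemMetric I N) (G : ℝ → BilinField I N) (r : ℝ) : ℝ :=
  ∫ x, mass I h Ghat.inner G r x ∂(riemannianVolume I Ghat)

/-- The function `h² (R_{rr} - R̊_{rr})` on `(a, b) × N`. -/
def ricciDefect (h : ℝ → ℝ) (Ghat : BilinField I N) (G : ℝ → BilinField I N) (p : ℝ × N) : ℝ :=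
  (h p.1) ^ 2 * (ricciRR I G p.1 p.2 - ricciRR I (warped I h Ghat) p.1 p.2)

end Manifold

/-- The real points of the interval `(a, b)`, whose ends may be infinite. -/
def openInterval (a b : EReal) : Set ℝ := {r : ℝ | a < r ∧ r < b}

/-- The filter of the real numbers `r ∈ (a, b)` tending to `c ∈ [a, b]`. -/
def nearIn (a b c : EReal) : Filter ℝ := comap Real.toEReal (𝓝[Ioo a b] c)

section Asymptotic

variable {d : ℕ} {H : Type*} [TopologicalSpace H]
  (I : ModelWithCorners ℝ (EuclideanSpace ℝ (Fin d)) H)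
  {N : Type*} [TopologicalSpace N] [ChartedSpace H N]

/-- The family `G(r)` of metrics on `N` is of class `C^∞` in `(r, x) ∈ (a, b) × N`. -/
def SmoothFamily [IsManifold I ∞ N] (a b : EReal) (G : ℝ → BilinField I N) : Prop :=
  ContMDiffOn (𝓘(ℝ, ℝ).prod I)
    (I.prod 𝓘(ℝ, EuclideanSpace ℝ (Fin d) →L[ℝ] EuclideanSpace ℝ (Fin d) →L[ℝ] ℝ)) ∞
    (fun p : ℝ × N =>
      (TotalSpace.mk' (EuclideanSpace ℝ (Fin d) →L[ℝ] EuclideanSpace ℝ (Fin d) →L[ℝ] ℝ)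
        (E := fun x : N => TangentSpace I x →L[ℝ] TangentSpace I x →L[ℝ] ℝ) p.2 (G p.1 p.2)))
    (openInterval a b ×ˢ univ)

/-- `‖G - G₀‖_{G₀} = o(1)` as `r → c` in `(a, b)`, uniformly on `N`. The norm with respect to `G₀`
of the bilinear form `T` is the least `ε` with `|T(u, v)| ≤ ε |u|_{G₀} |v|_{G₀}`. -/
def AsymptoticAt (a b c : EReal) (G G₀ : ℝ → BilinField I N) : Prop :=
  ∀ ε : ℝ, 0 < ε → ∀ᶠ r in nearIn a b c, ∀ (x : N) (u v : TangentSpace I x),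
    |G r x u v - G₀ r x u v| ≤ ε * √(G₀ r x u u) * √(G₀ r x v v)

end Asymptotic

end RadialMass

end

open Set Filter Topology MeasureTheory Bundle
open scoped Manifold ContDiff

noncomputable section

namespace RadialMass

open scoped Matrix

/-! Write `d = n - 1`, `S` for the Weingarten map, `H = tr S` and `c = h'/h`. In adapted coordinates
`S = ½ G⁻¹ ∂_r G`, and `R_rr = -∂_r H - tr S²` (Riccati); the model metric has `S = c · 1`.
Differentiating `m = h² (d c - H)` and inserting both Riccati equations gives `∂_r m = h² (R_rr -
R̊_rr) + h² tr((S - c)²)` (`hasDerivAt_mass`): the derivative of the weight `h²` supplies the cross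
term that completes the square.

Since `S - c` is self-adjoint for `G(r)`, the square is nonnegative (`trace_shape_sub_sq`).
Integrated over `M`, the identity writes the difference of the two limit masses as a sum of two
nonnegative terms. If it is zero, then `S = c` everywhere, because the defect is continuous and the
volume charges open sets (`limits_le_and_eq_zero_of_eq`). Now `S = c` means `∂_r G = 2 c G`, so `G /
h²` does not depend on `r` (`eq_smul_of_weingartenDefect_eq_zero`). Conversely, every warped metric
with factor `h` has mean curvature `d c`, whatever its fibre metric, so its mass vanishes. In the
asymptotic condition the factor `h²` cancels, which identifies the fibre metrics.

The geometric quantities at `x` are defined in the chart around `x`, which need not vary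
continuously with `x`. A change of chart conjugates `S` by a matrix independent of `r`, so traces
can be computed in a fixed chart; this gives the continuity needed for integration. -/

/-! ### Paths of matrices -/

section Paths

variable {κ : Type*} [Fintype κ] [DecidableEq κ]

/-- The entrywise derivative of a path of matrices. -/
def pathDeriv (γ : ℝ → Matrix κ κ ℝ) (r : ℝ) : Matrix κ κ ℝ :=
  Matrix.of fun A C => deriv (fun s => γ s A C) r

/-- The shape operator `½ γ⁻¹ ∂_r γ` of a path of matrices. -/
def shape (γ : ℝ → Matrix κ κ ℝ) (r : ℝ) : Matrix κ κ ℝ :=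
  (1 / 2 : ℝ) • ((γ r)⁻¹ * pathDeriv γ r)

omit [Fintype κ] [DecidableEq κ] in
theorem pathDeriv_transpose {γ : ℝ → Matrix κ κ ℝ} (hγ : ∀ s, (γ s)ᵀ = γ s) (r : ℝ) :
    (pathDeriv γ r)ᵀ = pathDeriv γ r := by
  ext A C
  simp only [pathDeriv, Matrix.transpose_apply, Matrix.of_apply]
  congr 1
  ext s
  rw [← Matrix.transpose_apply (γ s), hγ s]

omit [DecidableEq κ] in
theorem pathDeriv_conj {γ : ℝ → Matrix κ κ ℝ} {r : ℝ}
    (hd : ∀ A C, DifferentiableAt ℝ (fun s => γ s A C) r) (P : Matrix κ κ ℝ) :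
    pathDeriv (fun s => Pᵀ * γ s * P) r = Pᵀ * pathDeriv γ r * P := by
  ext A C
  simp only [pathDeriv, Matrix.of_apply, Matrix.mul_apply]
  refine HasDerivAt.deriv (HasDerivAt.fun_sum fun j _ => ?_)
  refine HasDerivAt.mul_const (HasDerivAt.fun_sum fun i _ => ?_) _
  exact (hd i j).hasDerivAt.const_mul _

/-- A constant change of basis turns the bilinear form `γ` into `Pᵀ γ P`, but the endomorphism `γ⁻¹
γ'` into a conjugate. Hence `tr S` and `tr S²` do not depend on the chart. -/
theorem shape_conj {γ : ℝ → Matrix κ κ ℝ} {r : ℝ}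
    (hd : ∀ A C, DifferentiableAt ℝ (fun s => γ s A C) r) {P : Matrix κ κ ℝ} (hP : IsUnit P.det) :
    shape (fun s => Pᵀ * γ s * P) r = P⁻¹ * shape γ r * P := by
  have h1 : Pᵀ⁻¹ * Pᵀ = 1 := Matrix.nonsing_inv_mul _ (by rwa [Matrix.det_transpose])
  simp only [shape, pathDeriv_conj hd, Matrix.mul_inv_rev, Matrix.mul_smul, Matrix.smul_mul]
  congr 1
  calc P⁻¹ * ((γ r)⁻¹ * Pᵀ⁻¹) * (Pᵀ * pathDeriv γ r * P)
      = P⁻¹ * (γ r)⁻¹ * (Pᵀ⁻¹ * Pᵀ) * pathDeriv γ r * P := by simp only [Matrix.mul_assoc]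
    _ = P⁻¹ * ((γ r)⁻¹ * pathDeriv γ r) * P := by
      rw [h1, Matrix.mul_one]; simp only [Matrix.mul_assoc]

theorem shape_smul_const {h : ℝ → ℝ} {r : ℝ} (hd : DifferentiableAt ℝ h r) (hr : h r ≠ 0)
    {g : Matrix κ κ ℝ} (hg : IsUnit g.det) :
    shape (fun s => (h s) ^ 2 • g) r = (deriv h r / h r) • (1 : Matrix κ κ ℝ) := by
  have h1 : pathDeriv (fun s => (h s) ^ 2 • g) r = (2 * h r * deriv h r) • g := by
    ext A C
    simp only [pathDeriv, Matrix.of_apply, Matrix.smul_apply, smul_eq_mul]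
    rw [(((hd.hasDerivAt.fun_pow 2)).mul_const (g A C)).deriv]
    simp
  have h2 : ((h r) ^ 2 • g)⁻¹ = ((h r) ^ 2)⁻¹ • g⁻¹ :=
    Matrix.inv_eq_left_inv (by
      rw [Matrix.smul_mul, Matrix.mul_smul, smul_smul, Matrix.nonsing_inv_mul _ hg,
        inv_mul_cancel₀ (pow_ne_zero 2 hr), one_smul])
  rw [shape, h1, h2, Matrix.smul_mul, Matrix.mul_smul, smul_smul, smul_smul,
    Matrix.nonsing_inv_mul _ hg]
  congr 1
  field_simp

open scoped MatrixOrder Matrix.Norms.L2Operator in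
/-- For `γ` positive definite and `B` symmetric, `tr((γ⁻¹B)²)` is a squared norm of `B`. -/
theorem trace_inv_mul_sq {γ B : Matrix κ κ ℝ} (hγ : γ.PosDef) (hB : Bᵀ = B) :
    0 ≤ (γ⁻¹ * B * (γ⁻¹ * B)).trace ∧ ((γ⁻¹ * B * (γ⁻¹ * B)).trace = 0 → B = 0) := by
  obtain ⟨L, hL⟩ : ∃ L : Matrix κ κ ℝ, γ⁻¹ = Lᵀ * L := by
    obtain ⟨L, hL⟩ := CStarAlgebra.nonneg_iff_eq_star_mul_self.1 hγ.inv.posSemidef.nonneg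
    exact ⟨L, by rw [hL, Matrix.star_eq_conjTranspose,
      Matrix.conjTranspose_eq_transpose_of_trivial]⟩
  have hdet : IsUnit L.det := by
    have : γ⁻¹.det ≠ 0 := hγ.inv.det_pos.ne'
    rw [hL, Matrix.det_mul] at this
    exact (right_ne_zero_of_mul this).isUnit
  -- `γ⁻¹ B` need not be symmetric, but by cyclicity of the trace it can be replaced by the
  -- symmetric matrix `L B Lᵀ`, whose square has trace equal to the sum of its squared entries.
  set K := L * B * Lᵀ with hK
  have hKt : Kᵀ = K := by
    rw [hK, Matrix.transpose_mul, Matrix.transpose_mul, Matrix.transpose_transpose, hB,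
      Matrix.mul_assoc]
  have e : (γ⁻¹ * B * (γ⁻¹ * B)).trace = (K.conjTranspose * K).trace := by
    rw [Matrix.conjTranspose_eq_transpose_of_trivial, hKt, hL]
    rw [Matrix.mul_assoc Lᵀ, Matrix.mul_assoc Lᵀ, Matrix.trace_mul_comm, hK]
    congr 1
    simp only [Matrix.mul_assoc]
  rw [e]
  refine ⟨(Matrix.posSemidef_conjTranspose_mul_self K).trace_nonneg, fun h0 => ?_⟩
  have hK0 : K = 0 := Matrix.trace_conjTranspose_mul_self_eq_zero_iff.1 h0
  have hdet' : IsUnit Lᵀ.det := by rwa [Matrix.det_transpose]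
  calc B = L⁻¹ * K * Lᵀ⁻¹ := by
        rw [hK, Matrix.mul_assoc L, Matrix.nonsing_inv_mul_cancel_left _ _ hdet,
          Matrix.mul_nonsing_inv_cancel_right _ _ hdet']
    _ = 0 := by simp [hK0]

/-- Factor `S - c = γ⁻¹ (½ γ' - c γ)` with a symmetric second factor. The equality case is the
linear equation that will make `γ / h²` constant. -/
theorem trace_shape_sub_sq {γ : ℝ → Matrix κ κ ℝ} (hγ : ∀ s, (γ s).PosDef) (r c : ℝ) :
    0 ≤ ((shape γ r - c • 1) * (shape γ r - c • 1)).trace ∧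
      (((shape γ r - c • 1) * (shape γ r - c • 1)).trace = 0 →
        pathDeriv γ r = (2 * c) • γ r) := by
  have hsym : ∀ s, (γ s)ᵀ = γ s := fun s => by
    rw [← Matrix.conjTranspose_eq_transpose_of_trivial, (hγ s).isHermitian.eq]
  have hu : IsUnit (γ r).det := (hγ r).det_pos.ne'.isUnit
  have e : shape γ r - c • 1 = (γ r)⁻¹ * ((1 / 2 : ℝ) • pathDeriv γ r - c • γ r) := by
    rw [Matrix.mul_sub, Matrix.mul_smul, Matrix.mul_smul, Matrix.nonsing_inv_mul _ hu, shape]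
  have hB : ((1 / 2 : ℝ) • pathDeriv γ r - c • γ r)ᵀ = (1 / 2 : ℝ) • pathDeriv γ r - c • γ r := by
    rw [Matrix.transpose_sub, Matrix.transpose_smul, Matrix.transpose_smul,
      pathDeriv_transpose hsym, hsym]
  rw [e]
  refine ⟨(trace_inv_mul_sq (hγ r) hB).1, fun h0 => ?_⟩
  have := (trace_inv_mul_sq (hγ r) hB).2 h0
  rw [mul_smul, ← sub_eq_zero.1 this, smul_smul]
  norm_num

/-- Expansion of `tr((S - c)²)`. -/
theorem trace_sub_smul_one_sq (S : Matrix κ κ ℝ) (c : ℝ) :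
    ((S - c • 1) * (S - c • 1)).trace
      = (S * S).trace - 2 * c * S.trace + c ^ 2 * Fintype.card κ := by
  have : (S - c • 1) * (S - c • 1) = S * S - (2 * c) • S + (c ^ 2) • (1 : Matrix κ κ ℝ) := by
    simp only [Matrix.sub_mul, Matrix.mul_sub, Matrix.mul_smul, Matrix.smul_mul, Matrix.mul_one,
      Matrix.one_mul]
    module
  rw [this, Matrix.trace_add, Matrix.trace_sub, Matrix.trace_smul, Matrix.trace_smul,
    Matrix.trace_one]
  simp

end Paths

/-! ### Smooth dependence on parameters -/

section Smooth

variable {W : Type*} [NormedAddCommGroup W] [NormedSpace ℝ W]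
  {κ : Type*} [Fintype κ] [DecidableEq κ]

theorem contDiffOn_det {s : Set W} {γ : W → Matrix κ κ ℝ}
    (h : ∀ A C, ContDiffOn ℝ ∞ (fun w => γ w A C) s) :
    ContDiffOn ℝ ∞ (fun w => (γ w).det) s := by
  simp only [Matrix.det_apply]
  refine ContDiffOn.sum fun σ _ => ?_
  exact (contDiffOn_prod fun i _ => h _ _).const_smul (Equiv.Perm.sign σ : ℤ)

theorem contDiffOn_inv {s : Set W} {γ : W → Matrix κ κ ℝ}
    (h : ∀ A C, ContDiffOn ℝ ∞ (fun w => γ w A C) s) (h0 : ∀ w ∈ s, (γ w).det ≠ 0) (A C : κ) :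
    ContDiffOn ℝ ∞ (fun w => (γ w)⁻¹ A C) s := by
  -- Cramer's rule reduces smoothness of the inverse to that of determinants.
  have e : (fun w => (γ w)⁻¹ A C)
      = fun w => (γ w).det⁻¹ * ((γ w).updateRow C (Pi.single A 1)).det := by
    ext w
    rw [Matrix.inv_def, Matrix.smul_apply, Matrix.adjugate_apply, Ring.inverse_eq_inv', smul_eq_mul]
  rw [e]
  refine ((contDiffOn_det h).inv h0).mul (contDiffOn_det fun i j => ?_)
  by_cases hi : i = C
  · subst hi
    simpa using contDiffOn_const
  · simpa [Matrix.updateRow_ne hi] using h i j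

variable {F : Type*} [NormedAddCommGroup F] [NormedSpace ℝ F] {J : Set ℝ} {T : Set F}

/-- Openness of `J` alone makes the radial derivative two-sided; `T` may contain boundary points of
a half space. -/
theorem hasDerivAt_slice (hJ : IsOpen J) {f : ℝ × F → ℝ} {r : ℝ} {y : F}
    (hr : r ∈ J) (hy : y ∈ T) {f' : ℝ × F →L[ℝ] ℝ}
    (hf : HasFDerivWithinAt f f' (J ×ˢ T) (r, y)) :
    HasDerivAt (fun s => f (s, y)) (f' (1, 0)) r := by
  have hg : HasDerivWithinAt (fun s : ℝ => (s, y)) ((1 : ℝ), (0 : F)) J r :=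
    ((hasDerivAt_id r).prodMk (hasDerivAt_const r y)).hasDerivWithinAt
  have := hf.comp_hasDerivWithinAt r hg fun s hs => mk_mem_prod hs hy
  exact this.hasDerivAt (hJ.mem_nhds hr)

theorem contDiffOn_deriv_slice (hJ : IsOpen J) (hT : UniqueDiffOn ℝ T) {f : ℝ × F → ℝ}
    (hf : ContDiffOn ℝ ∞ f (J ×ˢ T)) :
    ContDiffOn ℝ ∞ (fun z : ℝ × F => deriv (fun s => f (s, z.2)) z.1) (J ×ˢ T) := by
  have hu : UniqueDiffOn ℝ (J ×ˢ T) := hJ.uniqueDiffOn.prod hT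
  have h1 := (hf.fderivWithin hu (m := ∞) (by simp)).clm_apply
    (contDiffOn_const (c := ((1 : ℝ), (0 : F))))
  refine h1.congr fun z hz => ?_
  exact (hasDerivAt_slice hJ hz.1 hz.2
    ((hf.differentiableOn (by simp)) z hz).hasFDerivWithinAt).deriv

theorem differentiableAt_slice (hJ : IsOpen J) {f : ℝ × F → ℝ}
    (hf : ContDiffOn ℝ ∞ f (J ×ˢ T)) {r : ℝ} {y : F} (hr : r ∈ J) (hy : y ∈ T) :
    DifferentiableAt ℝ (fun s => f (s, y)) r :=
  (hasDerivAt_slice hJ hr hy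
    ((hf.differentiableOn (by simp)) (r, y) ⟨hr, hy⟩).hasFDerivWithinAt).differentiableAt

theorem contDiffOn_shape (hJ : IsOpen J) (hT : UniqueDiffOn ℝ T) {γ : ℝ × F → Matrix κ κ ℝ}
    (h : ∀ A C, ContDiffOn ℝ ∞ (fun z => γ z A C) (J ×ˢ T))
    (h0 : ∀ z ∈ J ×ˢ T, (γ z).det ≠ 0) (A C : κ) :
    ContDiffOn ℝ ∞ (fun z : ℝ × F => shape (fun s => γ (s, z.2)) z.1 A C) (J ×ˢ T) := by
  simp only [shape, Matrix.smul_apply, Matrix.mul_apply, pathDeriv, Matrix.of_apply, smul_eq_mul]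
  refine contDiffOn_const.mul (ContDiffOn.sum fun k _ => ?_)
  exact (contDiffOn_inv h h0 A k).mul (contDiffOn_deriv_slice hJ hT (h k C))

theorem contDiffOn_trace_shape (hJ : IsOpen J) (hT : UniqueDiffOn ℝ T)
    {γ : ℝ × F → Matrix κ κ ℝ}
    (h : ∀ A C, ContDiffOn ℝ ∞ (fun z => γ z A C) (J ×ˢ T))
    (h0 : ∀ z ∈ J ×ˢ T, (γ z).det ≠ 0) :
    ContDiffOn ℝ ∞ (fun z : ℝ × F => (shape (fun s => γ (s, z.2)) z.1).trace) (J ×ˢ T) := by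
  simp only [Matrix.trace, Matrix.diag]
  exact ContDiffOn.sum fun k _ => contDiffOn_shape hJ hT h h0 k k

theorem contDiffOn_trace_shape_sq (hJ : IsOpen J) (hT : UniqueDiffOn ℝ T)
    {γ : ℝ × F → Matrix κ κ ℝ}
    (h : ∀ A C, ContDiffOn ℝ ∞ (fun z => γ z A C) (J ×ˢ T))
    (h0 : ∀ z ∈ J ×ˢ T, (γ z).det ≠ 0) :
    ContDiffOn ℝ ∞ (fun z : ℝ × F =>
      (shape (fun s => γ (s, z.2)) z.1 * shape (fun s => γ (s, z.2)) z.1).trace) (J ×ˢ T) := by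
  simp only [Matrix.trace, Matrix.diag, Matrix.mul_apply]
  exact ContDiffOn.sum fun k _ => ContDiffOn.sum fun l _ =>
    (contDiffOn_shape hJ hT h h0 k l).mul (contDiffOn_shape hJ hT h h0 l k)

end Smooth

/-! ### Curvature of `dr² + γ` in adapted coordinates -/

section AdaptedCurvature

variable {d : ℕ} {T : Set (EuclideanSpace ℝ (Fin d))}
  {γ : ℝ × EuclideanSpace ℝ (Fin d) → Matrix (Fin d) (Fin d) ℝ}

theorem partialD_const {V κ : Type*} [NormedAddCommGroup V] [NormedSpace ℝ V]
    (D : Set V) (e : κ → V) (i : κ) (c : ℝ) (z : V) : partialD D e i (fun _ => c) z = 0 := by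
  simp [partialD]

/-- The coordinate domain has all of `ℝ` as radial factor, while smoothness is known only over `J`.
Intersecting with the open set `J × F` does not change the derivative within the domain. -/
theorem partialD_inl_eq_deriv {J : Set ℝ} (hJ : IsOpen J) (hT : UniqueDiffOn ℝ T)
    {f : ℝ × EuclideanSpace ℝ (Fin d) → ℝ} (hf : ContDiffOn ℝ ∞ f (J ×ˢ T)) {r : ℝ}
    {y : EuclideanSpace ℝ (Fin d)} (hr : r ∈ J) (hy : y ∈ T) :
    partialD (univ ×ˢ T) (adaptedFrame d) (Sum.inl ()) f (r, y) = deriv (fun s => f (s, y)) r := by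
  have hz : (r, y) ∈ J ×ˢ T := ⟨hr, hy⟩
  have hu : UniqueDiffOn ℝ (J ×ˢ T) := hJ.uniqueDiffOn.prod hT
  have e : fderivWithin ℝ f (univ ×ˢ T) (r, y) = fderivWithin ℝ f (J ×ˢ T) (r, y) := by
    have : J ×ˢ T = (univ ×ˢ T) ∩ (Prod.fst ⁻¹' J) := by ext; simp [and_comm]
    rw [this, fderivWithin_inter]
    exact (hJ.preimage continuous_fst).mem_nhds hr
  rw [partialD, e]
  exact (hasDerivAt_slice hJ hr hy
    ((hf.differentiableOn (by simp)) _ hz).hasFDerivWithinAt).deriv.symm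

theorem inv_adapted {M : Matrix (Fin d) (Fin d) ℝ} (hM : M.det ≠ 0) :
    (Matrix.fromBlocks (1 : Matrix Unit Unit ℝ) 0 0 M)⁻¹ = Matrix.fromBlocks 1 0 0 M⁻¹ := by
  have : IsUnit M := (Matrix.isUnit_iff_isUnit_det _).2 hM.isUnit
  rw [Matrix.inv_fromBlocks_zero₂₁_of_isUnit_iff _ _ _ (by simp [this])]
  simp

/-- The components `g_rr = 1` and `g_rA = 0` are constant, so the radial lines are geodesics. For
the same reason, the only Christoffel symbols with a lower index `r` that survive below are
`Γ^B_{rA} = Γ^B_{Ar}`, the entries of `S`. -/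
theorem christoffel_radial_radial (D : Set (ℝ × EuclideanSpace ℝ (Fin d)))
    (k : Unit ⊕ Fin d) (z : ℝ × EuclideanSpace ℝ (Fin d)) :
    christoffel D (adaptedFrame d) (fun w => Matrix.fromBlocks 1 0 0 (γ w)) k
      (Sum.inl ()) (Sum.inl ()) z = 0 := by
  simp [christoffel, partialD_const]

theorem christoffel_inl_radial (D : Set (ℝ × EuclideanSpace ℝ (Fin d)))
    (k : Unit ⊕ Fin d) {z : ℝ × EuclideanSpace ℝ (Fin d)} (hz : (γ z).det ≠ 0) :
    christoffel D (adaptedFrame d) (fun w => Matrix.fromBlocks 1 0 0 (γ w)) (Sum.inl ())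
      (Sum.inl ()) k z = 0 := by
  rcases k with k | k <;> simp [christoffel, inv_adapted hz, partialD_const]

theorem christoffel_inr_radial (D : Set (ℝ × EuclideanSpace ℝ (Fin d)))
    (B A : Fin d) {z : ℝ × EuclideanSpace ℝ (Fin d)} (hz : (γ z).det ≠ 0) :
    christoffel D (adaptedFrame d) (fun w => Matrix.fromBlocks 1 0 0 (γ w)) (Sum.inr B)
      (Sum.inl ()) (Sum.inr A) z
      = (1 / 2) * ∑ C, (γ z)⁻¹ B C *
        partialD D (adaptedFrame d) (Sum.inl ()) (fun w => γ w A C) z := by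
  simp [christoffel, inv_adapted hz, partialD_const]

theorem christoffel_inr_radial' (D : Set (ℝ × EuclideanSpace ℝ (Fin d)))
    (B A : Fin d) {z : ℝ × EuclideanSpace ℝ (Fin d)} (hz : (γ z).det ≠ 0) :
    christoffel D (adaptedFrame d) (fun w => Matrix.fromBlocks 1 0 0 (γ w)) (Sum.inr B)
      (Sum.inr A) (Sum.inl ()) z
      = (1 / 2) * ∑ C, (γ z)⁻¹ B C *
        partialD D (adaptedFrame d) (Sum.inl ()) (fun w => γ w A C) z := by
  simp [christoffel, inv_adapted hz, partialD_const]

variable {J : Set ℝ} (hJ : IsOpen J) (hT : UniqueDiffOn ℝ T)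
  (h : ∀ A C, ContDiffOn ℝ ∞ (fun z => γ z A C) (J ×ˢ T))
  (h0 : ∀ z ∈ J ×ˢ T, (γ z).det ≠ 0) (hsym : ∀ z, (γ z)ᵀ = γ z)

include hJ hT h h0 hsym

-- The Christoffel formula produces `∂_r γ_{AC}` where the matrix product has `∂_r γ_{CA}`; this is
-- where symmetry of `γ` enters.
omit h0 in
theorem sum_inv_mul_partialD_eq_shape {r : ℝ} {y : EuclideanSpace ℝ (Fin d)}
    (hr : r ∈ J) (hy : y ∈ T) (B A : Fin d) :
    (1 / 2) * ∑ C, (γ (r, y))⁻¹ B C *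
        partialD (univ ×ˢ T) (adaptedFrame d) (Sum.inl ()) (fun w => γ w A C) (r, y)
      = shape (fun s => γ (s, y)) r B A := by
  simp only [shape, Matrix.smul_apply, Matrix.mul_apply, smul_eq_mul]
  congr 1
  refine Finset.sum_congr rfl fun C _ => ?_
  rw [partialD_inl_eq_deriv hJ hT (h A C) hr hy,
    ← pathDeriv_transpose (fun s => hsym (s, y)) r]
  rfl

/-- `R_{rr} = -∂_r H - tr(S²)`. -/
theorem ricci_radial_eq {r : ℝ} {y : EuclideanSpace ℝ (Fin d)} (hr : r ∈ J) (hy : y ∈ T) :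
    ricci (univ ×ˢ T) (adaptedFrame d) (fun w => Matrix.fromBlocks 1 0 0 (γ w))
      (Sum.inl ()) (Sum.inl ()) (r, y)
      = - deriv (fun s => (shape (fun t => γ (t, y)) s).trace) r
        - (shape (fun s => γ (s, y)) r * shape (fun s => γ (s, y)) r).trace := by
  have hz := h0 _ (mk_mem_prod hr hy)
  have e1 : ∀ k, christoffel (univ ×ˢ T) (adaptedFrame d)
      (fun w => Matrix.fromBlocks 1 0 0 (γ w)) k (Sum.inl ()) (Sum.inl ()) = fun _ => 0 :=
    fun k => funext fun w => christoffel_radial_radial _ k w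
  have e2 : ∀ B A, partialD (univ ×ˢ T) (adaptedFrame d) (Sum.inl ())
      (christoffel (univ ×ˢ T) (adaptedFrame d)
        (fun w => Matrix.fromBlocks 1 0 0 (γ w)) (Sum.inr B) (Sum.inl ()) (Sum.inr A)) (r, y)
      = deriv (fun s => shape (fun t => γ (t, y)) s B A) r := by
    intro B A
    have hc : ContDiffOn ℝ ∞ (christoffel (univ ×ˢ T) (adaptedFrame d)
        (fun w => Matrix.fromBlocks 1 0 0 (γ w)) (Sum.inr B) (Sum.inl ()) (Sum.inr A))
        (J ×ˢ T) :=
      (contDiffOn_shape hJ hT h h0 B A).congr fun w hw => by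
        rw [christoffel_inr_radial _ _ _ (h0 _ hw)]
        exact sum_inv_mul_partialD_eq_shape hJ hT h hsym hw.1 hw.2 B A
    rw [partialD_inl_eq_deriv hJ hT hc hr hy]
    refine Filter.EventuallyEq.deriv_eq ?_
    filter_upwards [hJ.mem_nhds hr] with s hs
    rw [christoffel_inr_radial _ _ _ (h0 _ ⟨hs, hy⟩)]
    exact sum_inv_mul_partialD_eq_shape hJ hT h hsym hs hy B A
  have e3 : deriv (fun s => (shape (fun t => γ (t, y)) s).trace) r
      = ∑ B, deriv (fun s => shape (fun t => γ (t, y)) s B B) r := by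
    simp only [Matrix.trace, Matrix.diag]
    exact deriv_fun_sum fun B _ =>
      differentiableAt_slice hJ (contDiffOn_shape hJ hT h h0 B B) hr hy
  -- Since `Γ^k_{rr}` vanishes identically, the first and third terms of `R_rr` drop out. The second
  -- gives `-∂_r tr S` and the fourth `-tr S²`.
  simp only [ricci, Fintype.sum_sum_type, Finset.univ_unique, PUnit.default_eq_unit,
    Finset.sum_singleton, e1, e2, partialD_const, christoffel_inl_radial _ _ hz,
    christoffel_inr_radial _ _ _ hz, sum_inv_mul_partialD_eq_shape hJ hT h hsym hr hy]
  rw [e3]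
  simp [Matrix.trace, Matrix.mul_apply]

end AdaptedCurvature

/-! ### Matrices of bilinear forms in charts -/

section Charts

variable {d : ℕ} {H : Type*} [TopologicalSpace H]
  {I : ModelWithCorners ℝ (EuclideanSpace ℝ (Fin d)) H}
  {N : Type*} [TopologicalSpace N] [ChartedSpace H N] [IsManifold I ∞ N]

variable (I) in
/-- The coordinate basis at `x` of the chart around `x₀`. -/
def chartBasis (x₀ x : N) (hx : x ∈ (chartAt H x₀).source) :
    Module.Basis (Fin d) ℝ (TangentSpace I x) :=
  (trivializationAt (EuclideanSpace ℝ (Fin d)) (TangentSpace I) x₀).basisAt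
    (EuclideanSpace.basisFun (Fin d) ℝ).toBasis (x := x) (by simpa using hx)

theorem chartBasis_apply {x₀ x : N} (hx : x ∈ (chartAt H x₀).source) (A : Fin d) :
    chartBasis I x₀ x hx A = (trivializationAt (EuclideanSpace ℝ (Fin d))
      (TangentSpace I) x₀).symmL ℝ x (EuclideanSpace.single A (1 : ℝ)) := by
  rw [Trivialization.symmL_apply _ (by simpa using hx)]
  simp [chartBasis, Trivialization.basisAt]

-- The point `φ⁻¹(φ(x))` equals `x` only propositionally. All tangent spaces are the same model
-- space, so the same vectors can be used at both points.
omit [IsManifold I ∞ N] in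
theorem bilinField_congr (B : BilinField I N) {x x' : N} (h : x' = x)
    (u v : EuclideanSpace ℝ (Fin d)) :
    B x' (show TangentSpace I x' from u) (show TangentSpace I x' from v)
      = B x (show TangentSpace I x from u) (show TangentSpace I x from v) := by
  subst h
  rfl

theorem coordMatrix_apply_chart (B : BilinField I N) {x₀ x : N}
    (hx : x ∈ (chartAt H x₀).source) (A C : Fin d) :
    coordMatrix I B x₀ (extChartAt I x₀ x) A C
      = B x (chartBasis I x₀ x hx A) (chartBasis I x₀ x hx C) := by
  rw [chartBasis_apply, chartBasis_apply, TangentBundle.symmL_trivializationAt hx]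
  exact bilinField_congr B ((extChartAt I x₀).left_inv (by simpa using hx)) _ _

/-- The bilinear form of a field at a point. -/
def formAt (B : BilinField I N) (x : N) : LinearMap.BilinForm ℝ (TangentSpace I x) :=
  LinearMap.mk₂ ℝ (fun u v => B x u v) (by simp) (by simp) (by simp) (by simp)

theorem coordMatrix_eq_toMatrix (B : BilinField I N) {x₀ x : N}
    (hx : x ∈ (chartAt H x₀).source) :
    coordMatrix I B x₀ (extChartAt I x₀ x)
      = LinearMap.BilinForm.toMatrix (chartBasis I x₀ x hx) (formAt B x) := by
  ext A C
  rw [coordMatrix_apply_chart B hx]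
  simp [formAt, LinearMap.BilinForm.toMatrix_apply]

/-- Matrices in two charts around a point are related by a change of basis, which is the same for
all bilinear forms. -/
theorem exists_coordMatrix_change {x₀ x : N} (hx : x ∈ (chartAt H x₀).source) :
    ∃ P : Matrix (Fin d) (Fin d) ℝ, IsUnit P.det ∧ ∀ B : BilinField I N,
      coordMatrix I B x (extChartAt I x x) = Pᵀ * coordMatrix I B x₀ (extChartAt I x₀ x) * P := by
  refine ⟨(chartBasis I x₀ x hx).toMatrix (chartBasis I x x (mem_chart_source H x)), ?_,
    fun B => ?_⟩
  · rw [← Module.Basis.det_apply]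
    exact Module.Basis.isUnit_det _ _
  · rw [coordMatrix_eq_toMatrix B hx, coordMatrix_eq_toMatrix B (mem_chart_source H x),
      LinearMap.BilinForm.toMatrix_mul_basis_toMatrix]

theorem coordMatrix_transpose (G : RiemMetric I N) (x₀ : N) (y : EuclideanSpace ℝ (Fin d)) :
    (coordMatrix I G.inner x₀ y)ᵀ = coordMatrix I G.inner x₀ y := by
  ext A C
  simp only [coordMatrix, Matrix.transpose_apply, Matrix.of_apply]
  exact G.symm _ _ _

theorem coordMatrix_posDef (G : RiemMetric I N) {x₀ x : N} (hx : x ∈ (chartAt H x₀).source) :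
    (coordMatrix I G.inner x₀ (extChartAt I x₀ x)).PosDef := by
  refine Matrix.PosDef.of_dotProduct_mulVec_pos ?_ fun v hv => ?_
  · rw [Matrix.IsHermitian, Matrix.conjTranspose_eq_transpose_of_trivial, coordMatrix_transpose]
  · set b := chartBasis I x₀ x hx
    have hne : (∑ A, v A • b A) ≠ 0 := by
      intro h0
      apply hv
      ext A
      exact Fintype.linearIndependent_iff.1 b.linearIndependent v h0 A
    have key : G.inner x (∑ A, v A • b A) (∑ A, v A • b A)
        = star v ⬝ᵥ (coordMatrix I G.inner x₀ (extChartAt I x₀ x) *ᵥ v) := by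
      simp only [map_sum, map_smul, sum_apply, smul_apply, smul_eq_mul, dotProduct, Matrix.mulVec,
        coordMatrix_apply_chart G.inner hx, Finset.mul_sum, star_trivial]
      rw [Finset.sum_comm]
      exact Finset.sum_congr rfl fun A _ => Finset.sum_congr rfl fun C _ => by ring
    exact key ▸ G.pos x _ hne

theorem coordMatrix_posDef_of_mem_target (G : RiemMetric I N) {x₀ : N}
    {y : EuclideanSpace ℝ (Fin d)} (hy : y ∈ (extChartAt I x₀).target) :
    (coordMatrix I G.inner x₀ y).PosDef := by
  have := coordMatrix_posDef G (x₀ := x₀) (x := (extChartAt I x₀).symm y)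
    (by simpa using (extChartAt I x₀).map_target hy)
  rwa [(extChartAt I x₀).right_inv hy] at this

/-- The matrix entries are the smooth bundle section evaluated on the smooth local frame of the
trivialization, then pulled back by the inverse chart. -/
theorem contDiffOn_coordMatrix {a b : EReal} {G : ℝ → BilinField I N} (hG : SmoothFamily I a b G)
    (x₀ : N) (A C : Fin d) :
    ContDiffOn ℝ ∞ (fun z : ℝ × EuclideanSpace ℝ (Fin d) => coordMatrix I (G z.1) x₀ z.2 A C)
      (openInterval a b ×ˢ (extChartAt I x₀).target) := by
  set e := trivializationAt (EuclideanSpace ℝ (Fin d)) (TangentSpace I : N → Type _) x₀ with he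
  set bs := (EuclideanSpace.basisFun (Fin d) ℝ).toBasis
  have hbase : e.baseSet = (chartAt H x₀).source := by simp [he]
  have hframe : ∀ A, ContMDiffOn (𝓘(ℝ, ℝ).prod I) (I.prod 𝓘(ℝ, EuclideanSpace ℝ (Fin d))) ∞
      (fun p : ℝ × N => TotalSpace.mk' (EuclideanSpace ℝ (Fin d))
        (E := (TangentSpace I : N → Type _)) p.2 (e.localFrame bs A p.2))
      (openInterval a b ×ˢ (chartAt H x₀).source) := fun A =>
    (e.contMDiffOn_localFrame_baseSet (I := I) ∞ bs A).comp contMDiffOn_snd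
      (fun p hp => hbase ▸ hp.2)
  have h1 := ContMDiffOn.clm_bundle_apply₂ (F₃ := ℝ) (E₃ := fun _ : N => ℝ)
    (hG.mono (prod_mono_right (subset_univ _))) (hframe A) (hframe C)
  have h2 : ContMDiffOn (𝓘(ℝ, ℝ).prod I) 𝓘(ℝ, ℝ) ∞
      (fun p : ℝ × N => G p.1 p.2 (e.localFrame bs A p.2) (e.localFrame bs C p.2))
      (openInterval a b ×ˢ (chartAt H x₀).source) := by
    intro p hp
    have := h1 p hp
    simp only [contMDiffWithinAt_totalSpace] at this
    exact this.2
  have h3 : ContMDiffOn 𝓘(ℝ, ℝ × EuclideanSpace ℝ (Fin d)) (𝓘(ℝ, ℝ).prod I) ∞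
      (fun z : ℝ × EuclideanSpace ℝ (Fin d) => (z.1, (extChartAt I x₀).symm z.2))
      (openInterval a b ×ˢ (extChartAt I x₀).target) :=
    contDiff_fst.contMDiff.contMDiffOn.prodMk
      ((contMDiffOn_extChartAt_symm x₀).comp contDiff_snd.contMDiff.contMDiffOn fun z hz => hz.2)
  have h4 := h2.comp h3 fun z hz =>
    ⟨hz.1, by simpa using (extChartAt I x₀).map_target hz.2⟩
  refine (contMDiffOn_iff_contDiffOn.1 h4).congr fun z hz => ?_
  have hx : (extChartAt I x₀).symm z.2 ∈ (chartAt H x₀).source := by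
    simpa using (extChartAt I x₀).map_target hz.2
  have := coordMatrix_apply_chart (G z.1) hx A C
  rw [(extChartAt I x₀).right_inv hz.2] at this
  rw [this]
  simp only [Function.comp_apply, e.localFrame_apply_of_mem_baseSet bs (hbase ▸ hx)]
  rfl

theorem smoothFamily_const (G : RiemMetric I N) (a b : EReal) :
    SmoothFamily I a b (fun _ => G.inner) :=
  (G.contMDiff.comp contMDiff_snd).contMDiffOn

theorem isOpen_openInterval (a b : EReal) : IsOpen (openInterval a b) :=
  (isOpen_Ioo (a := a) (b := b)).preimage continuous_coe_real_ereal

omit [IsManifold I ∞ N] in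
theorem coordMatrix_warped (h : ℝ → ℝ) (B : BilinField I N) (r : ℝ) (x₀ : N)
    (y : EuclideanSpace ℝ (Fin d)) :
    coordMatrix I (warped I h B r) x₀ y = (h r) ^ 2 • coordMatrix I B x₀ y := by
  ext A C
  simp [coordMatrix, warped]
  rfl

theorem contDiffOn_coordMatrix_warped {a b : EReal} {h : ℝ → ℝ}
    (hh : ContDiffOn ℝ ∞ h (openInterval a b)) (G : RiemMetric I N) (x₀ : N) (A C : Fin d) :
    ContDiffOn ℝ ∞ (fun z : ℝ × EuclideanSpace ℝ (Fin d) =>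
        coordMatrix I (warped I h G.inner z.1) x₀ z.2 A C)
      (openInterval a b ×ˢ (extChartAt I x₀).target) := by
  simp only [coordMatrix_warped, Matrix.smul_apply, smul_eq_mul]
  exact ((hh.comp contDiffOn_fst fun z hz => hz.1).pow 2).mul
    (contDiffOn_coordMatrix (smoothFamily_const G a b) x₀ A C)

end Charts

/-! ### Curvature of regular families -/

section Regular

variable {d : ℕ} {H : Type*} [TopologicalSpace H]
  {I : ModelWithCorners ℝ (EuclideanSpace ℝ (Fin d)) H}
  {N : Type*} [TopologicalSpace N] [ChartedSpace H N] [IsManifold I ∞ N]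

/-- Families of symmetric bilinear forms, smooth and nondegenerate over `(a, b)`. -/
structure RegularFamily (a b : EReal) (G : ℝ → BilinField I N) : Prop where
  smooth : ∀ x₀ A C, ContDiffOn ℝ ∞
    (fun z : ℝ × EuclideanSpace ℝ (Fin d) => coordMatrix I (G z.1) x₀ z.2 A C)
    (openInterval a b ×ˢ (extChartAt I x₀).target)
  det_ne_zero : ∀ (x₀ : N), ∀ z ∈ openInterval a b ×ˢ (extChartAt I x₀).target,
    (coordMatrix I (G z.1) x₀ z.2).det ≠ 0
  symm : ∀ x₀ (z : ℝ × EuclideanSpace ℝ (Fin d)),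
    (coordMatrix I (G z.1) x₀ z.2)ᵀ = coordMatrix I (G z.1) x₀ z.2

theorem SmoothFamily.regularFamily {a b : EReal} {G : ℝ → RiemMetric I N}
    (hG : SmoothFamily I a b (fun r => (G r).inner)) :
    RegularFamily a b (fun r => (G r).inner) where
  smooth := contDiffOn_coordMatrix hG
  det_ne_zero _ _ hz := (coordMatrix_posDef_of_mem_target _ hz.2).det_pos.ne'
  symm _ _ := coordMatrix_transpose _ _ _

theorem regularFamily_warped {a b : EReal} {h : ℝ → ℝ}
    (hh : ContDiffOn ℝ ∞ h (openInterval a b)) (h_pos : ∀ r ∈ openInterval a b, 0 < h r)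
    (G : RiemMetric I N) : RegularFamily a b (warped I h G.inner) where
  smooth := contDiffOn_coordMatrix_warped hh G
  det_ne_zero _ z hz := by
    rw [coordMatrix_warped, Matrix.det_smul]
    exact mul_ne_zero (pow_ne_zero _ (pow_ne_zero _ (h_pos _ hz.1).ne'))
      (coordMatrix_posDef_of_mem_target G hz.2).det_pos.ne'
  symm _ _ := by rw [coordMatrix_warped, Matrix.transpose_smul, coordMatrix_transpose]

variable (I) in
/-- The path `r ↦ G_{AB}(r)` at the point `x`, in the chart around `x₀`. -/
def coordPath (G : ℝ → BilinField I N) (x₀ x : N) (s : ℝ) : Matrix (Fin d) (Fin d) ℝ :=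
  coordMatrix I (G s) x₀ (extChartAt I x₀ x)

-- Near `x₀`, a quantity defined pointwise in varying charts is replaced by its expression `f x₀` in
-- the single chart around `x₀`; this suffices since continuity is local.
omit [IsManifold I ∞ N] in
theorem continuousOn_of_charts {J : Set ℝ} {F : ℝ × N → ℝ}
    (f : N → ℝ × EuclideanSpace ℝ (Fin d) → ℝ)
    (hf : ∀ x₀, ContinuousOn (f x₀) (J ×ˢ (extChartAt I x₀).target))
    (hF : ∀ x₀, ∀ r ∈ J, ∀ x ∈ (chartAt H x₀).source, F (r, x) = f x₀ (r, extChartAt I x₀ x)) :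
    ContinuousOn F (J ×ˢ univ) := by
  rintro ⟨r, x₀⟩ ⟨hr, -⟩
  have hc : ContinuousOn (fun p : ℝ × N => f x₀ (p.1, extChartAt I x₀ p.2))
      (J ×ˢ (chartAt H x₀).source) := by
    refine (hf x₀).comp (continuousOn_fst.prodMk
      ((continuousOn_extChartAt x₀).comp continuousOn_snd fun p hp => ?_)) fun p hp => ?_
    · simpa using hp.2
    · exact ⟨hp.1, (extChartAt I x₀).map_source (by simpa using hp.2)⟩
  have h1 : ContinuousOn F (J ×ˢ (chartAt H x₀).source) :=
    hc.congr fun p hp => hF x₀ p.1 hp.1 p.2 hp.2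
  refine (h1 (r, x₀) ⟨hr, mem_chart_source H x₀⟩).mono_of_mem_nhdsWithin ?_
  rw [nhdsWithin_prod_eq]
  exact prod_mem_prod self_mem_nhdsWithin
    (mem_nhdsWithin_of_mem_nhds ((chartAt H x₀).open_source.mem_nhds (mem_chart_source H x₀)))

namespace RegularFamily

variable {a b : EReal} {G : ℝ → BilinField I N} (hG : RegularFamily a b G)

include hG

omit [IsManifold I ∞ N] in
theorem differentiableAt_coordPath {x₀ x : N} (hx : x ∈ (chartAt H x₀).source) {r : ℝ}
    (hr : r ∈ openInterval a b) (A C : Fin d) :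
    DifferentiableAt ℝ (fun s => coordPath I G x₀ x s A C) r :=
  differentiableAt_slice (isOpen_openInterval a b) (hG.smooth x₀ A C) hr
    ((extChartAt I x₀).map_source (by simpa using hx))

omit [IsManifold I ∞ N] in
theorem weingarten_eq_shape {r : ℝ} (hr : r ∈ openInterval a b) (x : N) :
    weingarten I G r x = shape (coordPath I G x x) r := by
  ext B A
  have hy := mem_extChartAt_target (I := I) x
  exact (christoffel_inr_radial' (γ := fun z => coordMatrix I (G z.1) x z.2) _ _ _
    (hG.det_ne_zero x _ ⟨hr, hy⟩)).trans
    (sum_inv_mul_partialD_eq_shape (isOpen_openInterval a b) (uniqueDiffOn_extChartAt_target x)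
      (hG.smooth x) (hG.symm x) hr hy B A)

/-- One `P` serves all `r`, because the change of chart takes place on `N` alone; so it passes
through `∂_r`. -/
theorem exists_weingarten_conj {x₀ x : N} (hx : x ∈ (chartAt H x₀).source) :
    ∃ P : Matrix (Fin d) (Fin d) ℝ, IsUnit P.det ∧ ∀ r ∈ openInterval a b,
      weingarten I G r x = P⁻¹ * shape (coordPath I G x₀ x) r * P := by
  obtain ⟨P, hP, h⟩ := exists_coordMatrix_change (I := I) hx
  refine ⟨P, hP, fun r hr => ?_⟩
  rw [hG.weingarten_eq_shape hr, ← shape_conj (hG.differentiableAt_coordPath hx hr) hP]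
  congr 1
  ext1 s
  exact h (G s)

theorem meanCurvature_eq {x₀ x : N} (hx : x ∈ (chartAt H x₀).source) {r : ℝ}
    (hr : r ∈ openInterval a b) :
    meanCurvature I G r x = (shape (coordPath I G x₀ x) r).trace := by
  obtain ⟨P, hP, h⟩ := hG.exists_weingarten_conj hx
  rw [meanCurvature, h r hr, Matrix.trace_mul_comm, ← Matrix.mul_assoc,
    Matrix.mul_nonsing_inv _ hP, Matrix.one_mul]

theorem trace_weingarten_sq_eq {x₀ x : N} (hx : x ∈ (chartAt H x₀).source) {r : ℝ}
    (hr : r ∈ openInterval a b) :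
    (weingarten I G r x * weingarten I G r x).trace
      = (shape (coordPath I G x₀ x) r * shape (coordPath I G x₀ x) r).trace := by
  obtain ⟨P, hP, h⟩ := hG.exists_weingarten_conj hx
  rw [h r hr]
  set S := shape (coordPath I G x₀ x) r
  have : P⁻¹ * S * P * (P⁻¹ * S * P) = P⁻¹ * (S * S * P) := by
    rw [Matrix.mul_assoc (P⁻¹ * S), ← Matrix.mul_assoc P, ← Matrix.mul_assoc P,
      Matrix.mul_nonsing_inv _ hP, Matrix.one_mul]
    simp only [Matrix.mul_assoc]
  rw [this, Matrix.trace_mul_comm, Matrix.mul_assoc, Matrix.mul_nonsing_inv _ hP, Matrix.mul_one]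

theorem deriv_meanCurvature_eq {x₀ x : N} (hx : x ∈ (chartAt H x₀).source) {r : ℝ}
    (hr : r ∈ openInterval a b) :
    deriv (fun s => meanCurvature I G s x) r
      = deriv (fun s => (shape (coordPath I G x₀ x) s).trace) r := by
  refine Filter.EventuallyEq.deriv_eq ?_
  filter_upwards [(isOpen_openInterval a b).mem_nhds hr] with s hs
  exact hG.meanCurvature_eq hx hs

omit [IsManifold I ∞ N] in
theorem contDiffOn_trace (x₀ : N) : ContDiffOn ℝ ∞
    (fun z : ℝ × EuclideanSpace ℝ (Fin d) =>
      (shape (fun s => coordMatrix I (G s) x₀ z.2) z.1).trace)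
    (openInterval a b ×ˢ (extChartAt I x₀).target) :=
  contDiffOn_trace_shape (γ := fun z => coordMatrix I (G z.1) x₀ z.2)
    (isOpen_openInterval a b) (uniqueDiffOn_extChartAt_target x₀)
    (hG.smooth x₀) (hG.det_ne_zero x₀)

theorem differentiableAt_meanCurvature {r : ℝ} (hr : r ∈ openInterval a b) (x : N) :
    DifferentiableAt ℝ (fun s => meanCurvature I G s x) r := by
  have h1 := differentiableAt_slice (isOpen_openInterval a b) (hG.contDiffOn_trace x) hr
    (mem_extChartAt_target (I := I) x)
  refine h1.congr_of_eventuallyEq ?_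
  filter_upwards [(isOpen_openInterval a b).mem_nhds hr] with s hs
  exact hG.meanCurvature_eq (mem_chart_source H x) hs

/-- The Riccati equation for `R_{rr}`. -/
theorem ricciRR_eq {r : ℝ} (hr : r ∈ openInterval a b) (x : N) :
    ricciRR I G r x = - deriv (fun s => meanCurvature I G s x) r
      - (weingarten I G r x * weingarten I G r x).trace := by
  rw [hG.deriv_meanCurvature_eq (mem_chart_source H x) hr,
    hG.trace_weingarten_sq_eq (mem_chart_source H x) hr]
  exact ricci_radial_eq (γ := fun z => coordMatrix I (G z.1) x z.2) (isOpen_openInterval a b)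
    (uniqueDiffOn_extChartAt_target x) (hG.smooth x) (hG.det_ne_zero x) (hG.symm x) hr
    (mem_extChartAt_target x)

theorem continuousOn_meanCurvature :
    ContinuousOn (fun p : ℝ × N => meanCurvature I G p.1 p.2) (openInterval a b ×ˢ univ) :=
  continuousOn_of_charts _ (fun x₀ => (hG.contDiffOn_trace x₀).continuousOn)
    fun _ _ hr _ hx => hG.meanCurvature_eq hx hr

theorem continuousOn_deriv_meanCurvature :
    ContinuousOn (fun p : ℝ × N => deriv (fun s => meanCurvature I G s p.2) p.1)
      (openInterval a b ×ˢ univ) :=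
  continuousOn_of_charts _ (fun x₀ => (contDiffOn_deriv_slice (isOpen_openInterval a b)
    (uniqueDiffOn_extChartAt_target x₀) (hG.contDiffOn_trace x₀)).continuousOn)
    fun _ _ hr _ hx => hG.deriv_meanCurvature_eq hx hr

theorem continuousOn_trace_weingarten_sq :
    ContinuousOn (fun p : ℝ × N => (weingarten I G p.1 p.2 * weingarten I G p.1 p.2).trace)
      (openInterval a b ×ˢ univ) :=
  continuousOn_of_charts _ (fun x₀ => (contDiffOn_trace_shape_sq
    (γ := fun z => coordMatrix I (G z.1) x₀ z.2) (isOpen_openInterval a b)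
    (uniqueDiffOn_extChartAt_target x₀) (hG.smooth x₀) (hG.det_ne_zero x₀)).continuousOn)
    fun _ _ hr _ hx => hG.trace_weingarten_sq_eq hx hr

end RegularFamily

/-! ### The evolution of the radial mass -/

variable {a b : EReal} {h : ℝ → ℝ} (hh : ContDiffOn ℝ ∞ h (openInterval a b))
  (h_pos : ∀ r ∈ openInterval a b, 0 < h r)

include hh in
theorem differentiableAt_of_mem {r : ℝ} (hr : r ∈ openInterval a b) : DifferentiableAt ℝ h r :=
  (hh.differentiableOn (by simp) r hr).differentiableAt ((isOpen_openInterval a b).mem_nhds hr)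

include hh h_pos

theorem weingarten_warped (Ghat : RiemMetric I N) {r : ℝ} (hr : r ∈ openInterval a b) (x : N) :
    weingarten I (warped I h Ghat.inner) r x = (deriv h r / h r) • 1 := by
  rw [(regularFamily_warped hh h_pos Ghat).weingarten_eq_shape hr]
  have : coordPath I (warped I h Ghat.inner) x x
      = fun s => (h s) ^ 2 • coordMatrix I Ghat.inner x (extChartAt I x x) :=
    funext fun s => coordMatrix_warped _ _ _ _ _
  rw [this]
  exact shape_smul_const (differentiableAt_of_mem hh hr) (h_pos r hr).ne'
    (coordMatrix_posDef Ghat (mem_chart_source H x)).det_pos.ne'.isUnit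

theorem meanCurvature_warped (Ghat : RiemMetric I N) {r : ℝ} (hr : r ∈ openInterval a b) (x : N) :
    meanCurvature I (warped I h Ghat.inner) r x = d * (deriv h r / h r) := by
  rw [meanCurvature, weingarten_warped hh h_pos Ghat hr]
  simp [mul_comm]

omit hh h_pos in
variable (I) in
/-- The square `h² |S - S̊|²` of the difference of the Weingarten maps. -/
def weingartenDefect (h : ℝ → ℝ) (G : ℝ → BilinField I N) (p : ℝ × N) : ℝ :=
  (h p.1) ^ 2 * ((weingarten I G p.1 p.2 - (deriv h p.1 / h p.1) • 1) *
    (weingarten I G p.1 p.2 - (deriv h p.1 / h p.1) • 1)).trace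

/-- With `c = h'/h`, the Riccati equations give `h² (R_rr - R̊_rr) + h² (tr S² - d c²)`, and
differentiating `h²` adds `2 h² c (d c - H)`. The non-Ricci terms sum to `h² (tr S² - 2 c H + d c²)
= h² tr((S - c)²)`. -/
theorem hasDerivAt_mass (Ghat : RiemMetric I N) {G : ℝ → BilinField I N}
    (hG : RegularFamily a b G) {r : ℝ} (hr : r ∈ openInterval a b) (x : N) :
    HasDerivAt (fun s => mass I h Ghat.inner G s x)
      (ricciDefect I h Ghat.inner G (r, x) + weingartenDefect I h G (r, x)) r := by
  have h0 := regularFamily_warped hh h_pos Ghat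
  have hne := (h_pos r hr).ne'
  have h1 := ((differentiableAt_of_mem hh hr).hasDerivAt.fun_pow 2).mul
    ((h0.differentiableAt_meanCurvature hr x).hasDerivAt.sub
      (hG.differentiableAt_meanCurvature hr x).hasDerivAt)
  refine h1.congr_deriv ?_
  simp only [ricciDefect, weingartenDefect, h0.ricciRR_eq hr, hG.ricciRR_eq hr,
    trace_sub_smul_one_sq, weingarten_warped hh h_pos Ghat hr, Pi.sub_apply,
    meanCurvature_warped hh h_pos Ghat hr]
  rw [← meanCurvature]
  simp only [Matrix.smul_mul, Matrix.mul_smul, Matrix.one_mul, Matrix.trace_smul,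
    Matrix.trace_one, Fintype.card_fin, smul_eq_mul]
  field_simp
  push_cast
  ring

theorem continuousOn_weingartenDefect {G : ℝ → BilinField I N} (hG : RegularFamily a b G) :
    ContinuousOn (weingartenDefect I h G) (openInterval a b ×ˢ univ) := by
  have hh' : ContinuousOn (deriv h) (openInterval a b) :=
    hh.continuousOn_deriv_of_isOpen (isOpen_openInterval a b) (by simp)
  have hmaps : MapsTo (Prod.fst : ℝ × N → ℝ) (openInterval a b ×ˢ univ) (openInterval a b) :=
    fun p hp => hp.1
  have c1 := hh.continuousOn.comp continuousOn_fst hmaps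
  have c2 := hh'.comp continuousOn_fst hmaps
  have c3 := c2.div c1 fun p hp => (h_pos p.1 hp.1).ne'
  have e : weingartenDefect I h G = fun p : ℝ × N => (h p.1) ^ 2 *
      ((weingarten I G p.1 p.2 * weingarten I G p.1 p.2).trace
        - 2 * (deriv h p.1 / h p.1) * meanCurvature I G p.1 p.2
        + (deriv h p.1 / h p.1) ^ 2 * d) := by
    ext p
    rw [weingartenDefect, trace_sub_smul_one_sq, meanCurvature, Fintype.card_fin]
  rw [e]
  exact (c1.pow 2).mul ((hG.continuousOn_trace_weingarten_sq.sub
    ((continuousOn_const.mul c3).mul hG.continuousOn_meanCurvature)).add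
    ((c3.pow 2).mul continuousOn_const))

theorem continuousOn_mass (Ghat : RiemMetric I N) {G : ℝ → BilinField I N}
    (hG : RegularFamily a b G) :
    ContinuousOn (fun p : ℝ × N => mass I h Ghat.inner G p.1 p.2) (openInterval a b ×ˢ univ) := by
  have c1 := hh.continuousOn.comp (continuousOn_fst (s := openInterval a b ×ˢ (univ : Set N)))
    fun p hp => hp.1
  exact (c1.pow 2).mul ((regularFamily_warped hh h_pos Ghat).continuousOn_meanCurvature.sub
    hG.continuousOn_meanCurvature)

theorem continuousOn_ricciDefect (Ghat : RiemMetric I N) {G : ℝ → BilinField I N}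
    (hG : RegularFamily a b G) :
    ContinuousOn (ricciDefect I h Ghat.inner G) (openInterval a b ×ˢ univ) := by
  have c1 := hh.continuousOn.comp (continuousOn_fst (s := openInterval a b ×ˢ (univ : Set N)))
    fun p hp => hp.1
  have key : ∀ {G' : ℝ → BilinField I N}, RegularFamily a b G' →
      ContinuousOn (fun p : ℝ × N => ricciRR I G' p.1 p.2) (openInterval a b ×ˢ univ) :=
    fun hG' => (hG'.continuousOn_deriv_meanCurvature.neg.sub
      hG'.continuousOn_trace_weingarten_sq).congr fun p hp => hG'.ricciRR_eq hp.1 p.2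
  exact (c1.pow 2).mul ((key hG).sub (key (regularFamily_warped hh h_pos Ghat)))

omit hh h_pos in
theorem weingartenDefect_nonneg {G : ℝ → RiemMetric I N}
    (hG : RegularFamily a b (fun r => (G r).inner)) {r : ℝ} (hr : r ∈ openInterval a b) (x : N) :
    0 ≤ weingartenDefect I h (fun r => (G r).inner) (r, x) := by
  rw [weingartenDefect, hG.weingarten_eq_shape hr]
  exact mul_nonneg (sq_nonneg _) (trace_shape_sub_sq
    (fun s => coordMatrix_posDef (G s) (mem_chart_source H x)) _ _).1

/-- If the Weingarten maps agree, then `G(r) / h(r)²` is constant. -/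
theorem eq_smul_of_weingartenDefect_eq_zero {G : ℝ → RiemMetric I N}
    (hG : RegularFamily a b (fun r => (G r).inner))
    (x : N) (h0 : ∀ r ∈ openInterval a b, weingartenDefect I h (fun r => (G r).inner) (r, x) = 0)
    {r s : ℝ} (hr : r ∈ openInterval a b) (hs : s ∈ openInterval a b) :
    (G r).inner x = ((h r) ^ 2 * ((h s) ^ 2)⁻¹) • (G s).inner x := by
  set γ := coordPath I (fun r => (G r).inner) x x with hγ
  have hx := mem_chart_source H x
  -- Vanishing of the defect reads `γ' = 2 (h'/h) γ`, so `γ / h²` has zero derivative.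
  have hd : ∀ t ∈ openInterval a b, ∀ A C,
      HasDerivAt (fun u => γ u A C * ((h u) ^ 2)⁻¹) 0 t := by
    intro t ht A C
    have hne := (h_pos t ht).ne'
    have h1 := h0 t ht
    rw [weingartenDefect, hG.weingarten_eq_shape ht] at h1
    have h2 := (trace_shape_sub_sq (fun s => coordMatrix_posDef (G s) hx) _ _).2
      ((mul_eq_zero.1 h1).resolve_left (pow_ne_zero 2 hne))
    have h3 : deriv (fun u => γ u A C) t = 2 * (deriv h t / h t) * γ t A C :=
      congrFun (congrFun h2 A) C
    have h4 := (hG.differentiableAt_coordPath hx ht A C).hasDerivAt.mul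
      (((differentiableAt_of_mem hh ht).hasDerivAt.fun_pow 2).fun_inv (pow_ne_zero 2 hne))
    refine h4.congr_deriv ?_
    rw [← hγ, h3]
    field_simp
    simp
  have hpre : IsPreconnected (openInterval a b) := by
    refine Set.OrdConnected.isPreconnected ⟨fun u hu v hv w hw => ?_⟩
    exact ⟨hu.1.trans_le (EReal.coe_le_coe_iff.2 hw.1),
      (EReal.coe_le_coe_iff.2 hw.2).trans_lt hv.2⟩
  have hconst : ∀ A C, γ r A C = ((h r) ^ 2 * ((h s) ^ 2)⁻¹) * γ s A C := by
    intro A C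
    have h1 : γ r A C * ((h r) ^ 2)⁻¹ = γ s A C * ((h s) ^ 2)⁻¹ :=
      (isOpen_openInterval a b).is_const_of_deriv_eq_zero hpre
      (fun t ht => (hd t ht A C).differentiableAt.differentiableWithinAt)
      (fun t ht => (hd t ht A C).deriv) hr hs
    have hne := (h_pos r hr).ne'
    have hne' := (h_pos s hs).ne'
    field_simp at h1 ⊢
    linarith
  refine ContinuousLinearMap.coe_injective ((chartBasis I x x hx).ext fun A =>
    ContinuousLinearMap.coe_injective ((chartBasis I x x hx).ext fun C => ?_))
  have := hconst A C
  simp only [hγ, coordPath, coordMatrix_apply_chart _ hx] at this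
  simpa using this

end Regular

/-! ### The Riemannian volume measure of a compact manifold -/

section Volume

variable {d : ℕ} {H : Type*} [TopologicalSpace H]
  {I : ModelWithCorners ℝ (EuclideanSpace ℝ (Fin d)) H}
  {N : Type*} [TopologicalSpace N] [ChartedSpace H N] [IsManifold I ∞ N]

theorem continuousOn_coordMatrix (G : RiemMetric I N) (c : N) (A C : Fin d) :
    ContinuousOn (fun y => coordMatrix I G.inner c y A C) (extChartAt I c).target := by
  have := (contDiffOn_coordMatrix (smoothFamily_const G ⊥ ⊤) c A C).continuousOn
  exact this.comp (f := fun y => ((0 : ℝ), y)) (continuousOn_const.prodMk continuousOn_id)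
    fun y hy => ⟨⟨EReal.bot_lt_coe 0, EReal.coe_lt_top 0⟩, hy⟩

theorem continuousOn_sqrt_det (G : RiemMetric I N) (c : N) :
    ContinuousOn (fun y => √(coordMatrix I G.inner c y).det) (extChartAt I c).target := by
  refine Real.continuous_sqrt.comp_continuousOn ?_
  simp only [Matrix.det_apply]
  exact continuousOn_finsetSum _ fun σ _ => ContinuousOn.const_smul
    (continuousOn_finsetProd _ fun i _ => continuousOn_coordMatrix G c _ _) _

theorem continuousOn_chartDensity (G : RiemMetric I N) {ρ : N → ℝ} (hρ : Continuous ρ) (c : N) :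
    ContinuousOn (fun y => ρ ((extChartAt I c).symm y) * √(coordMatrix I G.inner c y).det)
      (extChartAt I c).target :=
  (hρ.comp_continuousOn (continuousOn_extChartAt_symm c)).mul (continuousOn_sqrt_det G c)

omit [IsManifold I ∞ N] in
theorem measurableSet_extChartAt_target (c : N) : MeasurableSet (extChartAt I c).target := by
  rw [extChartAt_target]
  exact (((chartAt H c).open_target.preimage I.continuous_symm).measurableSet).inter
    I.isClosed_range.measurableSet

variable [MeasurableSpace N] [BorelSpace N]

omit [IsManifold I ∞ N] in
theorem chartVolume_apply (B : BilinField I N) (ρ : N → ℝ) (c : N) {s : Set N}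
    (hs : MeasurableSet s) :
    chartVolume I B ρ c s = ∫⁻ y in (extChartAt I c).symm ⁻¹' s ∩ (extChartAt I c).target,
      ENNReal.ofReal (ρ ((extChartAt I c).symm y) * √(coordMatrix I B c y).det) := by
  have hm : AEMeasurable (extChartAt I c).symm
      (volume.restrict (extChartAt I c).target) :=
    (continuousOn_extChartAt_symm c).aemeasurable (measurableSet_extChartAt_target c)
  rw [chartVolume, Measure.map_apply_of_aemeasurable
    (hm.mono_ac (withDensity_absolutelyContinuous _ _)) hs, withDensity_apply',
    Measure.restrict_restrict' (measurableSet_extChartAt_target c)]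

/-- The chart domain may have infinite volume, but the density lives on the image of `tsupport ρ`, a
compact subset of the target on which it is continuous. -/
theorem isFiniteMeasure_chartVolume [CompactSpace N] (G : RiemMetric I N) {ρ : N → ℝ}
    (hρ : Continuous ρ) {c : N} (hc : tsupport ρ ⊆ (chartAt H c).source) :
    IsFiniteMeasure (chartVolume I G.inner ρ c) := by
  refine ⟨?_⟩
  rw [chartVolume_apply _ _ _ MeasurableSet.univ, preimage_univ, univ_inter]
  set f := fun y => ENNReal.ofReal
    (ρ ((extChartAt I c).symm y) * √(coordMatrix I G.inner c y).det) with hf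
  have hsub : tsupport ρ ⊆ (extChartAt I c).source := by simpa using hc
  set K := extChartAt I c '' tsupport ρ with hK
  have hKc : IsCompact K := (isClosed_tsupport ρ).isCompact.image_of_continuousOn
    ((continuousOn_extChartAt c).mono hsub)
  have hKT : K ⊆ (extChartAt I c).target := by
    rintro _ ⟨x, hx, rfl⟩
    exact (extChartAt I c).map_source (hsub hx)
  have h0 : ∀ y ∈ (extChartAt I c).target \ K, f y = 0 := by
    rintro y ⟨hy, hyK⟩
    have : ρ ((extChartAt I c).symm y) = 0 := by
      by_contra hne
      exact hyK ⟨_, subset_tsupport ρ hne, (extChartAt I c).right_inv hy⟩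
    rw [hf]
    beta_reduce
    rw [this, zero_mul, ENNReal.ofReal_zero]
  have h1 : ∫⁻ y in (extChartAt I c).target, f y = ∫⁻ y in K, f y := by
    rw [← lintegral_inter_add_sdiff f _ hKc.measurableSet, inter_eq_self_of_subset_right hKT,
      setLIntegral_congr_fun ((measurableSet_extChartAt_target c).diff hKc.measurableSet) h0]
    simp
  rw [h1]
  exact (((continuousOn_chartDensity G hρ c).mono hKT).integrableOn_compact hKc).lintegral_lt_top

theorem chartVolume_pos (G : RiemMetric I N) {ρ : N → ℝ} {c : N} {U : Set N} (hU : IsOpen U)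
    (hρ : ∀ x ∈ U, 0 < ρ x) (hρc : Continuous ρ) (hUs : U ⊆ (chartAt H c).source)
    (hne : U.Nonempty) :
    0 < chartVolume I G.inner ρ c U := by
  rw [chartVolume_apply _ _ _ hU.measurableSet]
  set T := (extChartAt I c).target with hT
  set W := (extChartAt I c).symm ⁻¹' U ∩ T with hW
  obtain ⟨O, hO, hOW⟩ : ∃ O, IsOpen O ∧ W = O ∩ range I := by
    obtain ⟨O, hO, hOW⟩ := continuousOn_iff'.1 (continuousOn_extChartAt_symm (I := I) c) U hU
    refine ⟨O ∩ I.symm ⁻¹' (chartAt H c).target,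
      hO.inter ((chartAt H c).open_target.preimage I.continuous_symm), ?_⟩
    rw [hW, hT, hOW, extChartAt_target, inter_assoc]
  have hWm : MeasurableSet W := hOW ▸ hO.measurableSet.inter I.isClosed_range.measurableSet
  have hvol : 0 < volume W := by
    obtain ⟨x, hx⟩ := hne
    have hxs : x ∈ (extChartAt I c).source := by simpa using hUs hx
    have hy : extChartAt I c x ∈ O ∩ range I := by
      rw [← hOW]
      refine ⟨?_, (extChartAt I c).map_source hxs⟩
      rwa [mem_preimage, (extChartAt I c).left_inv hxs]
    -- At a boundary point the preimage of `U` is only relatively open. As the range of the model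
    -- lies in the closure of its interior, it still contains a nonempty open set.
    have hmeet : (O ∩ interior (range I)).Nonempty :=
      mem_closure_iff.1 (I.range_subset_closure_interior hy.2) O hO hy.1
    exact ((hO.inter isOpen_interior).measure_pos volume hmeet).trans_le
      (measure_mono (hOW ▸ inter_subset_inter_right O interior_subset))
  have hcont := (continuousOn_chartDensity G hρc c).mono (inter_subset_right : W ⊆ T)
  refine pos_iff_ne_zero.2 fun h0 => hvol.ne' ?_
  rw [lintegral_eq_zero_iff' (hcont.aemeasurable hWm).ennreal_ofReal] at h0
  have h1 : ∀ᵐ _ ∂(volume.restrict W), False := by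
    filter_upwards [h0, ae_restrict_mem hWm] with y hy hyW
    refine absurd hy (ENNReal.ofReal_pos.2 (mul_pos (hρ _ hyW.1) (Real.sqrt_pos.2 ?_))).ne'
    exact (coordMatrix_posDef_of_mem_target G hyW.2).det_pos
  simpa [ae_iff] using h1

variable [T2Space N] [CompactSpace N]

omit [MeasurableSpace N] [BorelSpace N] in
theorem chartPartition_isSubordinate :
    (chartPartition I N).IsSubordinate (fun x => (chartAt H x).source) :=
  Classical.choose_spec (SmoothPartitionOfUnity.exists_isSubordinate_chartAt_source I N)

theorem isFiniteMeasure_riemannianVolume (G : RiemMetric I N) :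
    IsFiniteMeasure (riemannianVolume I G) := by
  have hfin : {c : N | (Function.support (chartPartition I N c)).Nonempty}.Finite :=
    (chartPartition I N).locallyFinite.finite_nonempty_of_compact
  have hz : ∀ c, c ∉ hfin.toFinset → chartVolume I G.inner (chartPartition I N c) c univ = 0 := by
    intro c hc
    have : ∀ x, chartPartition I N c x = 0 := by
      simpa [Set.Nonempty] using hc
    rw [chartVolume_apply _ _ _ MeasurableSet.univ]
    simp [this]
  refine ⟨?_⟩
  rw [riemannianVolume, Measure.sum_apply _ MeasurableSet.univ, tsum_eq_sum hz]
  refine ENNReal.sum_lt_top.2 fun c _ => ?_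
  have := isFiniteMeasure_chartVolume G (chartPartition I N c).contMDiff.continuous
    (chartPartition_isSubordinate (I := I) c)
  exact measure_lt_top _ _

theorem isOpenPosMeasure_riemannianVolume (G : RiemMetric I N) :
    (riemannianVolume I G).IsOpenPosMeasure := by
  refine ⟨fun U hU ⟨x, hx⟩ => ?_⟩
  obtain ⟨c, hc⟩ := (chartPartition I N).exists_pos_of_mem (mem_univ x)
  have hcont : Continuous (chartPartition I N c) := (chartPartition I N c).contMDiff.continuous
  set V := U ∩ {x | 0 < chartPartition I N c x}
  have hV : IsOpen V := hU.inter (isOpen_lt continuous_const hcont)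
  have h1 : 0 < chartVolume I G.inner (chartPartition I N c) c V :=
    chartVolume_pos G hV (fun x hx => hx.2) hcont
      (fun x hx => chartPartition_isSubordinate (I := I) c
        (subset_tsupport _ (ne_of_gt hx.2))) ⟨x, hx, hc⟩
  refine (h1.trans_le ?_).ne'
  exact (measure_mono inter_subset_left).trans
    (Measure.le_sum (fun c : N => chartVolume I G.inner (chartPartition I N c) c) c U)

end Volume

/-! ### Intervals with ends in the extended reals -/

section Intervals

variable {a b : EReal}

theorem Icc_subset_openInterval {r s : ℝ} (hr : r ∈ openInterval a b) (hs : s ∈ openInterval a b) :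
    Icc r s ⊆ openInterval a b := fun _ ht =>
  ⟨hr.1.trans_le (EReal.coe_le_coe_iff.2 ht.1), (EReal.coe_le_coe_iff.2 ht.2).trans_lt hs.2⟩

theorem eventually_mem_openInterval (c : EReal) : ∀ᶠ r in nearIn a b c, r ∈ openInterval a b :=
  (eventually_mem_nhdsWithin (a := c) (s := Ioo a b)).comap Real.toEReal

theorem eventually_lt_nearIn_left {t : ℝ} (ht : t ∈ openInterval a b) :
    ∀ᶠ r in nearIn a b a, r < t := by
  have : ∀ᶠ z in 𝓝[Ioo a b] a, z < (t : EReal) :=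
    eventually_nhdsWithin_of_eventually_nhds (eventually_lt_nhds ht.1)
  exact (this.comap Real.toEReal).mono fun r hr => EReal.coe_lt_coe_iff.1 hr

theorem eventually_gt_nearIn_right {t : ℝ} (ht : t ∈ openInterval a b) :
    ∀ᶠ r in nearIn a b b, t < r := by
  have : ∀ᶠ z in 𝓝[Ioo a b] b, (t : EReal) < z :=
    eventually_nhdsWithin_of_eventually_nhds (eventually_gt_nhds ht.2)
  exact (this.comap Real.toEReal).mono fun r hr => EReal.coe_lt_coe_iff.1 hr

theorem nearIn_neBot (hab : a < b) {c : EReal} (hc : c ∈ Icc a b) : (nearIn a b c).NeBot := by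
  have h1 : (𝓝[Ioo a b] c).NeBot := by
    rw [← mem_closure_iff_nhdsWithin_neBot, closure_Ioo hab.ne]
    exact hc
  refine comap_neBot fun s hs => ?_
  obtain ⟨z, hz, hz'⟩ := h1.nonempty_of_mem (inter_mem hs self_mem_nhdsWithin)
  refine ⟨z.toReal, ?_⟩
  rwa [EReal.coe_toReal (hz'.2.trans_le le_top).ne (bot_le.trans_lt hz'.1).ne']

instance nearIn_isCountablyGenerated (c : EReal) : (nearIn a b c).IsCountablyGenerated := by
  unfold nearIn
  infer_instance

end Intervals

/-! ### Integrated evolution equations -/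

section Evolution

variable {N : Type*} [TopologicalSpace N] [T2Space N] [CompactSpace N] [SecondCountableTopology N]
  [MeasurableSpace N] [BorelSpace N] {μ : Measure N} [IsFiniteMeasure μ] {a b : EReal}

omit [T2Space N] [CompactSpace N] [BorelSpace N] in
theorem prod_restrict_Ioc {r s : ℝ} (hr : r ∈ openInterval a b) (hs : s ∈ openInterval a b) :
    ((volume.restrict (openInterval a b)).prod μ).restrict (Ioc r s ×ˢ univ)
      = (volume.restrict (Ioc r s)).prod μ := by
  rw [← Measure.prod_restrict, Measure.restrict_univ, Measure.restrict_restrict measurableSet_Ioc,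
    inter_eq_self_of_subset_left (Ioc_subset_Icc_self.trans (Icc_subset_openInterval hr hs))]

theorem integrable_of_continuousOn {F : ℝ × N → ℝ} (hF : ContinuousOn F (openInterval a b ×ˢ univ))
    {r s : ℝ} (hr : r ∈ openInterval a b) (hs : s ∈ openInterval a b) :
    Integrable F ((volume.restrict (Ioc r s)).prod μ) := by
  have h1 : IntegrableOn F (Icc r s ×ˢ univ) ((volume : Measure ℝ).prod μ) :=
    (hF.mono (prod_mono_left (Icc_subset_openInterval hr hs))).integrableOn_compact
      (isCompact_Icc.prod isCompact_univ)
  have h2 := h1.mono_set (prod_mono_left (t := univ) (Ioc_subset_Icc_self (a := r) (b := s)))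
  rwa [IntegrableOn, ← Measure.prod_restrict, Measure.restrict_univ] at h2

/-- The fundamental theorem of calculus along each radial line, followed by Fubini. Compactness of
`[r, s] × N` provides integrability. -/
theorem integral_sub_integral_of_hasDerivAt {m : ℝ → N → ℝ} {F : ℝ × N → ℝ}
    (hF : ContinuousOn F (openInterval a b ×ˢ univ))
    (hm : ∀ r ∈ openInterval a b, Continuous (m r))
    (hd : ∀ r ∈ openInterval a b, ∀ x, HasDerivAt (fun s => m s x) (F (r, x)) r)
    {r s : ℝ} (hr : r ∈ openInterval a b) (hs : s ∈ openInterval a b) (hrs : r ≤ s) :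
    (∫ x, m s x ∂μ) - ∫ x, m r x ∂μ = ∫ p, F p ∂((volume.restrict (Ioc r s)).prod μ) := by
  have hmi : ∀ t ∈ openInterval a b, Integrable (m t) μ := fun t ht =>
    integrableOn_univ.1 ((hm t ht).continuousOn.integrableOn_compact isCompact_univ)
  rw [← integral_sub (hmi s hs) (hmi r hr),
    integral_prod_symm _ (integrable_of_continuousOn hF hr hs)]
  refine integral_congr_ae (Eventually.of_forall fun x => ?_)
  have hsub := Icc_subset_openInterval hr hs
  have hcont : ContinuousOn (fun t => F (t, x)) (uIcc r s) := by
    rw [uIcc_of_le hrs]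
    exact hF.comp (continuousOn_id.prodMk continuousOn_const) fun t ht => ⟨hsub ht, mem_univ _⟩
  beta_reduce
  rw [← intervalIntegral.integral_of_le hrs, ← intervalIntegral.integral_eq_sub_of_hasDerivAt
    (fun t ht => hd t (hsub (uIcc_of_le hrs ▸ ht)) x) hcont.intervalIntegrable]

omit [T2Space N] [CompactSpace N] [BorelSpace N] in
theorem tendsto_integral_Ioc {F : ℝ × N → ℝ}
    (hF : Integrable F ((volume.restrict (openInterval a b)).prod μ)) :
    Tendsto (fun i : ℝ × ℝ => ∫ p, F p ∂((volume.restrict (Ioc i.1 i.2)).prod μ))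
      (nearIn a b a ×ˢ nearIn a b b)
      (𝓝 (∫ p, F p ∂((volume.restrict (openInterval a b)).prod μ))) := by
  have hcover : AECover ((volume.restrict (openInterval a b)).prod μ)
      (nearIn a b a ×ˢ nearIn a b b) (fun i : ℝ × ℝ => Ioc i.1 i.2 ×ˢ (univ : Set N)) := by
    refine ⟨?_, fun i => measurableSet_Ioc.prod MeasurableSet.univ⟩
    have h1 : ∀ᵐ p ∂((volume.restrict (openInterval a b)).prod μ), p.1 ∈ openInterval a b :=
      Measure.quasiMeasurePreserving_fst.ae
        (ae_restrict_mem (isOpen_openInterval a b).measurableSet)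
    filter_upwards [h1] with p hp
    filter_upwards [(eventually_lt_nearIn_left hp).prod_mk (eventually_gt_nearIn_right hp)]
      with i hi
    exact ⟨⟨hi.1, hi.2.le⟩, mem_univ _⟩
  refine (hcover.integral_tendsto_of_countably_generated hF).congr' ?_
  filter_upwards [(eventually_mem_openInterval a).prod_mk (eventually_mem_openInterval b)]
    with i hi
  rw [prod_restrict_Ioc hi.1 hi.2]

/-- If `∂_r m = F + Q` with `Q ≥ 0` and `∫ F ≥ 0`, then the limits of `∫ m` at the ends
are ordered, and if they agree, then `Q = 0`. -/
theorem limits_le_and_eq_zero_of_eq [μ.IsOpenPosMeasure] (hab : a < b) {m : ℝ → N → ℝ}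
    {F Q : ℝ × N → ℝ}
    (hF : ContinuousOn F (openInterval a b ×ˢ univ))
    (hQ : ContinuousOn Q (openInterval a b ×ˢ univ))
    (hQ0 : ∀ r ∈ openInterval a b, ∀ x, 0 ≤ Q (r, x))
    (hm : ∀ r ∈ openInterval a b, Continuous (m r))
    (hd : ∀ r ∈ openInterval a b, ∀ x, HasDerivAt (fun s => m s x) (F (r, x) + Q (r, x)) r)
    {mA mB : ℝ} (hA : Tendsto (fun r => ∫ x, m r x ∂μ) (nearIn a b a) (𝓝 mA))
    (hB : Tendsto (fun r => ∫ x, m r x ∂μ) (nearIn a b b) (𝓝 mB))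
    (hFi : Integrable F ((volume.restrict (openInterval a b)).prod μ))
    (hF0 : 0 ≤ ∫ p, F p ∂((volume.restrict (openInterval a b)).prod μ)) :
    mA ≤ mB ∧ (mB = mA → ∀ r ∈ openInterval a b, ∀ x, Q (r, x) = 0) := by
  have : (nearIn a b a).NeBot := nearIn_neBot hab ⟨le_rfl, hab.le⟩
  have : (nearIn a b b).NeBot := nearIn_neBot hab ⟨hab.le, le_rfl⟩
  -- `Q` is not assumed integrable on `M`. Its integrals over compact strips converge because the
  -- masses and the integrals of `F` do.
  have hlim : Tendsto (fun i : ℝ × ℝ => ∫ p, Q p ∂((volume.restrict (Ioc i.1 i.2)).prod μ))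
      (nearIn a b a ×ˢ nearIn a b b)
      (𝓝 (mB - mA - ∫ p, F p ∂((volume.restrict (openInterval a b)).prod μ))) := by
    refine (((hB.comp tendsto_snd).sub (hA.comp tendsto_fst)).sub
      (tendsto_integral_Ioc hFi)).congr' ?_
    obtain ⟨t, ht⟩ := (eventually_mem_openInterval (a := a) (b := b) a).exists
    filter_upwards [(eventually_mem_openInterval a).prod_mk (eventually_mem_openInterval b),
      (eventually_lt_nearIn_left ht).prod_mk (eventually_gt_nearIn_right ht)] with i hi hi'
    have h1 := integral_sub_integral_of_hasDerivAt (μ := μ) (hF.add hQ) hm hd hi.1 hi.2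
      (hi'.1.trans hi'.2).le
    have h2 := integral_add (integrable_of_continuousOn (μ := μ) hF hi.1 hi.2)
      (integrable_of_continuousOn (μ := μ) hQ hi.1 hi.2)
    simp only [Pi.add_apply] at h1
    simp only [Function.comp_apply]
    rw [h1, h2]
    ring
  have hnn : ∀ {r s : ℝ}, r ∈ openInterval a b → s ∈ openInterval a b →
      0 ≤ᵐ[(volume.restrict (Ioc r s)).prod μ] Q := by
    intro r s hr hs
    have h1 : ∀ᵐ p ∂((volume.restrict (Ioc r s)).prod μ), p.1 ∈ Ioc r s :=
      Measure.quasiMeasurePreserving_fst.ae (ae_restrict_mem measurableSet_Ioc)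
    filter_upwards [h1] with p hp
    exact hQ0 p.1 (Icc_subset_openInterval hr hs (Ioc_subset_Icc_self hp)) p.2
  have hge : 0 ≤ mB - mA - ∫ p, F p ∂((volume.restrict (openInterval a b)).prod μ) := by
    refine ge_of_tendsto hlim ?_
    filter_upwards [(eventually_mem_openInterval a).prod_mk (eventually_mem_openInterval b)]
      with i hi
    exact integral_nonneg_of_ae (hnn hi.1 hi.2)
  refine ⟨by linarith, fun heq r hr x => ?_⟩
  obtain ⟨u, hu, hur⟩ := ((eventually_mem_openInterval a).and (eventually_lt_nearIn_left hr)).exists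
  obtain ⟨v, hv, hrv⟩ :=
    ((eventually_mem_openInterval b).and (eventually_gt_nearIn_right hr)).exists
  -- Strip integrals of `Q` increase with the strip, so each is at most the limit, which is `-∫ F ≤
  -- 0` when the end masses agree.
  have hle : ∫ p, Q p ∂((volume.restrict (Ioc u v)).prod μ) ≤ 0 := by
    have : ∫ p, Q p ∂((volume.restrict (Ioc u v)).prod μ)
        ≤ mB - mA - ∫ p, F p ∂((volume.restrict (openInterval a b)).prod μ) := by
      refine ge_of_tendsto hlim ?_
      filter_upwards [(eventually_mem_openInterval a).prod_mk (eventually_mem_openInterval b),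
        (eventually_lt_nearIn_left hu).prod_mk (eventually_gt_nearIn_right hv)] with i hi hi'
      refine integral_mono_measure ?_ (hnn hi.1 hi.2) (integrable_of_continuousOn hQ hi.1 hi.2)
      exact Measure.prod_mono (Measure.restrict_mono (Ioc_subset_Ioc hi'.1.le hi'.2.le) le_rfl)
        le_rfl
    linarith
  have hae : Q =ᵐ[(volume.restrict (Ioc u v)).prod μ] 0 :=
    (integral_eq_zero_iff_of_nonneg_ae (hnn hu hv) (integrable_of_continuousOn hQ hu hv)).1
      (le_antisymm hle (integral_nonneg_of_ae (hnn hu hv)))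
  have hae' : Q =ᵐ[((volume : Measure ℝ).prod μ).restrict (Ioo u v ×ˢ univ)] 0 := by
    rw [← Measure.prod_restrict, Measure.restrict_univ]
    exact (Measure.prod_mono (Measure.restrict_mono Ioo_subset_Ioc_self le_rfl)
      le_rfl).absolutelyContinuous.ae_le hae
  -- A continuous function vanishing almost everywhere on an open strip vanishes at each of its
  -- points, since the product measure charges open sets.
  exact Measure.eqOn_open_of_ae_eq hae' (isOpen_Ioo.prod isOpen_univ)
    (hQ.mono (prod_mono_left (Ioo_subset_Icc_self.trans (Icc_subset_openInterval hu hv))))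
    continuousOn_const (x := (r, x)) ⟨⟨hur, hrv⟩, mem_univ _⟩

end Evolution

/-! ### Rescaled metrics and the rigidity statement -/

section Rigidity

variable {d : ℕ} {H : Type*} [TopologicalSpace H]
  {I : ModelWithCorners ℝ (EuclideanSpace ℝ (Fin d)) H}
  {N : Type*} [TopologicalSpace N] [ChartedSpace H N] [IsManifold I ∞ N]

set_option synthInstance.maxHeartbeats 400000 in
/-- The metric `c² G`. -/
def scaledMetric (G : RiemMetric I N) (c : ℝ) (hc : 0 < c) : RiemMetric I N where
  inner x := (c ^ 2) • G.inner x
  symm x v w := by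
    change c ^ 2 * G.inner x v w = c ^ 2 * G.inner x w v
    rw [G.symm]
  pos x v hv := mul_pos (pow_pos hc 2) (G.pos x v hv)
  isVonNBounded x := by
    -- The unit ball of `c² G` is the image of that of `G` under multiplication by `c⁻¹`.
    have h1 := Bornology.IsVonNBounded.image (G.isVonNBounded x)
      (c⁻¹ • ContinuousLinearMap.id ℝ (TangentSpace I x))
    refine h1.subset fun v hv => ?_
    refine ⟨c • v, ?_, ?_⟩
    · have hv' : c ^ 2 * G.inner x v v < 1 := hv
      change G.inner x (c • v) (c • v) < 1
      rw [map_smul, map_smul, smul_apply, smul_eq_mul, smul_eq_mul]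
      linarith
    · exact inv_smul_smul₀ hc.ne' v
  contMDiff := G.contMDiff.const_smul_section (a := c ^ 2)

/-- A warped metric has no radial mass. -/
theorem totalMass_eq_zero_of_warped [T2Space N] [SigmaCompactSpace N] [MeasurableSpace N]
    {a b : EReal} {h : ℝ → ℝ} (hh : ContDiffOn ℝ ∞ h (openInterval a b))
    (h_pos : ∀ r ∈ openInterval a b, 0 < h r) (Ghat Gtilde : RiemMetric I N)
    {G : ℝ → RiemMetric I N} (hG : RegularFamily a b (fun r => (G r).inner))
    (hw : ∀ r ∈ openInterval a b, ∀ x, (G r).inner x = warped I h Gtilde.inner r x)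
    {r : ℝ} (hr : r ∈ openInterval a b) :
    totalMass I h Ghat (fun r => (G r).inner) r = 0 := by
  have hW := regularFamily_warped hh h_pos Gtilde
  have key : ∀ x, mass I h Ghat.inner (fun r => (G r).inner) r x = 0 := by
    intro x
    have e : meanCurvature I (fun r => (G r).inner) r x
        = meanCurvature I (warped I h Gtilde.inner) r x := by
      rw [hG.meanCurvature_eq (mem_chart_source H x) hr,
        hW.meanCurvature_eq (mem_chart_source H x) hr]
      have hloc : ∀ s ∈ openInterval a b, coordPath I (fun r => (G r).inner) x x s
          = coordPath I (warped I h Gtilde.inner) x x s := by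
        intro s hs
        have : (G s).inner = warped I h Gtilde.inner s := funext (hw s hs)
        simp only [coordPath, this]
      -- The families agree only over `(a, b)`. This suffices for the derivative in the shape
      -- operator, as the interval is a neighbourhood of `r`.
      rw [shape, shape, hloc r hr]
      congr 3
      ext A C
      refine Filter.EventuallyEq.deriv_eq ?_
      filter_upwards [(isOpen_openInterval a b).mem_nhds hr] with s hs
      rw [hloc s hs]
    rw [mass, e, meanCurvature_warped hh h_pos Ghat hr, meanCurvature_warped hh h_pos Gtilde hr,
      sub_self, mul_zero]
  simp [totalMass, key]

/-- Two metrics whose warped products are asymptotic are equal. -/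
theorem eq_of_asymptoticAt_warped {a b c : EReal} (hab : a < b) (hc : c ∈ Icc a b) {h : ℝ → ℝ}
    (h_pos : ∀ r ∈ openInterval a b, 0 < h r) {Ghat Gtilde : RiemMetric I N}
    (has : AsymptoticAt I a b c (warped I h Gtilde.inner) (warped I h Ghat.inner)) (x : N) :
    Gtilde.inner x = Ghat.inner x := by
  have := nearIn_neBot hab hc
  refine ContinuousLinearMap.ext fun u => ContinuousLinearMap.ext fun v => ?_
  set K := √(Ghat.inner x u u) * √(Ghat.inner x v v) with hK
  -- Both sides of the asymptotic bound scale by `h(r)²`, so one `r` close to `c` gives a bound free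
  -- of `r`, whatever `h` does at the end.
  have key : ∀ ε : ℝ, 0 < ε → |Gtilde.inner x u v - Ghat.inner x u v| ≤ ε * K := by
    intro ε hε
    obtain ⟨r, hr, hrJ⟩ := ((has ε hε).and (eventually_mem_openInterval c)).exists
    have hpos := h_pos r hrJ
    have h1 : |(h r) ^ 2 * Gtilde.inner x u v - (h r) ^ 2 * Ghat.inner x u v|
        ≤ ε * √((h r) ^ 2 * Ghat.inner x u u) * √((h r) ^ 2 * Ghat.inner x v v) := hr x u v
    rw [← mul_sub, abs_mul, abs_of_pos (pow_pos hpos 2), Real.sqrt_mul (sq_nonneg _),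
      Real.sqrt_mul (sq_nonneg _), Real.sqrt_sq hpos.le] at h1
    refine le_of_mul_le_mul_left (h1.trans_eq ?_) (pow_pos hpos 2)
    rw [hK]
    ring
  have hlim : Tendsto (fun ε : ℝ => ε * K) (𝓝[>] 0) (𝓝 0) := by
    have : Tendsto (fun ε : ℝ => ε * K) (𝓝 0) (𝓝 (0 * K)) := tendsto_id.mul_const K
    rw [zero_mul] at this
    exact this.mono_left nhdsWithin_le_nhds
  have h0 : |Gtilde.inner x u v - Ghat.inner x u v| ≤ 0 :=
    ge_of_tendsto hlim (eventually_mem_nhdsWithin.mono fun ε hε => key ε hε)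
  exact sub_eq_zero.1 (abs_nonpos_iff.1 h0)

omit [IsManifold I ∞ N] in
theorem AsymptoticAt.congr_left {a b c : EReal} {G G' G₀ : ℝ → BilinField I N}
    (h : AsymptoticAt I a b c G G₀) (hG : ∀ r ∈ openInterval a b, ∀ x, G r x = G' r x) :
    AsymptoticAt I a b c G' G₀ := fun ε hε => by
  filter_upwards [h ε hε, eventually_mem_openInterval c] with r hr hrJ x u v
  rw [← hG r hrJ x]
  exact hr x u v

end Rigidity

end RadialMass

end

theorem mainTheorem4
    (n : ℕ) (hn : 2 ≤ n)
    {H : Type*} [TopologicalSpace H]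
    (I : ModelWithCorners ℝ (EuclideanSpace ℝ (Fin (n - 1))) H)
    {N : Type*} [TopologicalSpace N] [ChartedSpace H N] [IsManifold I ∞ N]
    [T2Space N] [CompactSpace N] [MeasurableSpace N] [BorelSpace N]
    (a b : EReal) (hab : a < b)
    (h : ℝ → ℝ) (h_smooth : ContDiffOn ℝ ∞ h (RadialMass.openInterval a b))
    (h_pos : ∀ r ∈ RadialMass.openInterval a b, 0 < h r)
    (Ghat : RadialMass.RiemMetric I N)
    (G : ℝ → RadialMass.RiemMetric I N)
    (G_smooth : RadialMass.SmoothFamily I a b (fun r => (G r).inner))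
    (massA massB : ℝ)
    (h_massA : Tendsto (RadialMass.totalMass I h Ghat (fun r => (G r).inner))
      (RadialMass.nearIn a b a) (𝓝 massA))
    (h_massB : Tendsto (RadialMass.totalMass I h Ghat (fun r => (G r).inner))
      (RadialMass.nearIn a b b) (𝓝 massB))
    (h_integrable : Integrable (RadialMass.ricciDefect I h Ghat.inner (fun r => (G r).inner))
      ((volume.restrict (RadialMass.openInterval a b)).prod (RadialMass.riemannianVolume I Ghat)))
    (h_nonneg : 0 ≤ ∫ p, RadialMass.ricciDefect I h Ghat.inner (fun r => (G r).inner) p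
      ∂((volume.restrict (RadialMass.openInterval a b)).prod
        (RadialMass.riemannianVolume I Ghat))) :
    massA ≤ massB ∧
    (massB = massA ↔ ∃ Gtilde : RadialMass.RiemMetric I N,
      ∀ r ∈ RadialMass.openInterval a b, ∀ x : N,
        (G r).inner x = RadialMass.warped I h Gtilde.inner r x) ∧
    ((∃ r₀ ∈ Icc a b, RadialMass.AsymptoticAt I a b r₀ (fun r => (G r).inner)
        (RadialMass.warped I h Ghat.inner)) →
      (massB = massA ↔ ∀ r ∈ RadialMass.openInterval a b, ∀ x : N,
        (G r).inner x = RadialMass.warped I h Ghat.inner r x)) := by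
  have hneA := RadialMass.nearIn_neBot hab (c := a) ⟨le_rfl, hab.le⟩
  have hneB := RadialMass.nearIn_neBot hab (c := b) ⟨hab.le, le_rfl⟩
  have : SecondCountableTopology H := I.secondCountableTopology
  have : SecondCountableTopology N := ChartedSpace.secondCountable_of_sigmaCompact H N
  have := RadialMass.isFiniteMeasure_riemannianVolume Ghat
  have := RadialMass.isOpenPosMeasure_riemannianVolume Ghat
  have hG := G_smooth.regularFamily
  have hlim := RadialMass.limits_le_and_eq_zero_of_eq hab
    (RadialMass.continuousOn_ricciDefect h_smooth h_pos Ghat hG)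
    (RadialMass.continuousOn_weingartenDefect h_smooth h_pos hG)
    (fun r hr x => RadialMass.weingartenDefect_nonneg hG hr x)
    (fun r hr => continuousOn_univ.1
      ((RadialMass.continuousOn_mass h_smooth h_pos Ghat hG).comp
        (continuousOn_const.prodMk continuousOn_id) fun x hx => ⟨hr, hx⟩))
    (fun r hr x => RadialMass.hasDerivAt_mass h_smooth h_pos Ghat hG hr x)
    h_massA h_massB h_integrable h_nonneg
  have hiff : massB = massA ↔ ∃ Gtilde : RadialMass.RiemMetric I N,
      ∀ r ∈ RadialMass.openInterval a b, ∀ x : N,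
        (G r).inner x = RadialMass.warped I h Gtilde.inner r x := by
    refine ⟨fun heq => ?_, fun ⟨Gtilde, hw⟩ => ?_⟩
    · obtain ⟨s, hs⟩ := (RadialMass.eventually_mem_openInterval (a := a) (b := b) a).exists
      -- The fibre metric is the constant value of `G / h²`, read off at an arbitrary `s`.
      refine ⟨RadialMass.scaledMetric (G s) (h s)⁻¹ (inv_pos.2 (h_pos s hs)), fun r hr x => ?_⟩
      rw [RadialMass.eq_smul_of_weingartenDefect_eq_zero h_smooth h_pos hG x
        (fun t ht => hlim.2 heq t ht x) hr hs, mul_smul, ← inv_pow]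
      rfl
    · have hz : ∀ c, Tendsto (RadialMass.totalMass I h Ghat (fun r => (G r).inner))
          (RadialMass.nearIn a b c) (𝓝 0) := fun c => tendsto_const_nhds.congr' <|
        (RadialMass.eventually_mem_openInterval c).mono fun r hr =>
          (RadialMass.totalMass_eq_zero_of_warped h_smooth h_pos Ghat Gtilde hG hw hr).symm
      rw [tendsto_nhds_unique h_massB (hz b), tendsto_nhds_unique h_massA (hz a)]
  refine ⟨hlim.1, hiff, fun ⟨r₀, hr₀, has⟩ => ⟨fun heq r hr x => ?_, fun hw => hiff.2 ⟨Ghat, hw⟩⟩⟩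
  obtain ⟨Gtilde, hw⟩ := hiff.1 heq
  rw [hw r hr x, RadialMass.warped, RadialMass.warped,
    RadialMass.eq_of_asymptoticAt_warped hab hr₀ h_pos (has.congr_left hw) x]
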